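/- **Setting.** Let $A$ be a category with a terminal object $1$. *Pruned opfibrations.* A functor $p:E\to A$ is an *opfibration* if every arrow $pe\to b$ has a cocartesian lift $e\to e'$. Let $i:E_1\hookrightarrow E$ be the inclusion of the fibre over $1$; for an opfibration it has a left adjoint $i_L$, pushing $e$ forward along $pe\to 1$. The opfibration $p$ is *pruned* if it has a fully faithful right adjoint $p_R:A\to E$ such that the products $p_R a\times iY$ exist in $E$ for all $a\in A$, $Y\in E_1$, and $p$ preserves them. Pruned opfibrations over $A$ form a 2-category $\mathrm{OpFib}_\ast(A)$: 1-cells are the functors over $A$ that preserve cocartesian arrows, 2-cells are the natural transformations over $A$ (with vertical components). *Pruned comonads.* A *parametrized comonad* over $A$ consists of a category $X$ and a functor $S$, $a\mapsto S_a$, from $A$ to the category of comonads on $X$ and comonad morphisms. It is *pruned* if $X$ has a terminal object and $S_1$ is (isomorphic to) the identity functor. Pruned comonads form a 2-category $\mathrm{CoMnd}_\ast(A)$: a 1-cell $(X,S)\to(Y,T)$ is a functor $V:X\to Y$ with arrows $VS_ax\to T_aVx$, natural in $a$ and $x$ and compatible with the counits and comultiplications; a 2-cell is a natural transformation between the functors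 $V$ compatible with these arrows. *The two constructions.* The *coEilenberg–Moore opfibration* $p^S:A\ltimes^S X\to A$ of $S$ has as total category the category whose objects are the pairs of an object $a\in A$ and an $S_a$-coalgebra $(x,\xi)$, and whose arrows $(a,x,\xi)\to(b,y,\theta)$ are the pairs $f:a\to b$, $g:x\to y$ with $S_b(g)\circ S_f\circ\xi=\theta\circ g$; the functor $p^S$ is the projection. For a pruned opfibration $p$, the comonad $S^p$ on $E_1$, parametrized by $A$, is the one associated with the adjunction $$\langle p,i_L\rangle : E\;\rightleftarrows\; A\times E_1 : (p_R\times i),\qquad \langle p,i_L\rangle\dashv (p_R\times i),$$ so that $S^p_a(Y)=i_L(p_R a\times iY)$. Let $\eta_p:E\to A\ltimes^{S^p}E_1$ be the comparison functor over $A$; it sends $e$ to the pair of $pe$ and the coalgebra with carrier $i_Le$ whose structure map is the image under $i_L$ of the canonical arrow $e\to p_Rpe\times ii_Le$. **Theorem.** 1. The opfibration $p^S$ is pruned for every pruned $S$, the comonad $S^p$ is pruned for every pruned $p$, and these assignments extend to pseudofunctors $$\mathrm{OpFib}_\ast(A)\to\mathrm{CoMnd}_\ast(A),\ p\mapsto S^p,\qquad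 \mathrm{CoMnd}_\ast(A)\to\mathrm{OpFib}_\ast(A),\ S\mapsto p^S,$$ the first of which is left (bi)adjoint to the second, with unit $\eta$: the functors $\eta_p$ are 1-cells of $\mathrm{OpFib}_\ast(A)$, they are the components of a pseudonatural transformation, and for every pruned $p$ and $S$ the functor $$\mathrm{CoMnd}_\ast(A)(S^p,S)\longrightarrow\mathrm{OpFib}_\ast(A)(p,p^S),\qquad g\mapsto p^{g}\circ\eta_p,$$ is an equivalence of categories. 2. For every pruned opfibration $p$ the following are equivalent: (i) $p$ is equivalent, in $\mathrm{OpFib}_\ast(A)$, to the coEilenberg–Moore opfibration $p^S$ of some pruned comonad $S$; (ii) $\eta_p$ is an equivalence in $\mathrm{OpFib}_\ast(A)$; (iii) the functor $\eta_p:E\to A\ltimes^{S^p}E_1$ is an equivalence of categories. 3. For a pruned comonad $S$ on $X$, the category $X$ has an initial object if and only if the fibre of $p^S$ over $1$ has one. (Hence the biadjunction restricts to the pruned opfibrations whose fibre over $1$ has an initial object and the pruned comonads whose category of carriers has one.) -/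

import Mathlib

open CategoryTheory CategoryTheory.Limits CategoryTheory.Functor

set_option linter.checkUnivs false
set_option linter.unusedVariables false

universe w₁ v₁ u₁ w v u

namespace Opfib

/-! ### Opfibrations and pruned opfibrations -/

section Opfibrations

variable {A : Type u₁} [Category.{v₁} A] {E : Type u} [Category.{v} E]

/-- A functor `p : E ⥤ A` is an opfibration if every arrow `p e ⟶ b` has a cocartesian lift
with domain `e`. -/
def IsOpfibration (p : E ⥤ A) : Prop :=
  ∀ (e : E) (b : A) (f : p.obj e ⟶ b), ∃ (e' : E) (φ : e ⟶ e'), p.IsStronglyCocartesian f φ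

/-- The terminal fibre of `p`. -/
abbrev TermFiber [HasTerminal A] (p : E ⥤ A) : Type _ := p.Fiber (⊤_ A)

/-- The inclusion of the terminal fibre into the total category. -/
noncomputable abbrev incl [HasTerminal A] (p : E ⥤ A) : TermFiber p ⥤ E := Fiber.fiberInclusion

/-- A pruned opfibration: an opfibration `p` with a fully faithful right adjoint `r`, such that the
products `r a × y` exist in the total category for all `a` in the base and all `y` in the terminal
fibre, and are preserved by `p`. -/
structure IsPruned [HasTerminal A] (p : E ⥤ A) : Prop where
  isOpfibration : IsOpfibration p
  exists_rightAdjoint : ∃ (r : A ⥤ E) (_ : p ⊣ r), r.Full ∧ r.Faithful ∧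
    ∀ (a : A) (Y : TermFiber p), HasBinaryProduct (r.obj a) ((incl p).obj Y) ∧
      PreservesLimit (pair (r.obj a) ((incl p).obj Y)) p

namespace IsOpfibration

variable [HasTerminal A] {p : E ⥤ A} (h : IsOpfibration p)

/-- The reindexing of `e` along `p e ⟶ ⊤_ A`. -/
noncomputable def reflObj (e : E) : TermFiber p :=
  ⟨(h e _ (terminal.from (p.obj e))).choose,
    have := (h e _ (terminal.from (p.obj e))).choose_spec.choose_spec
    IsHomLift.codomain_eq p (terminal.from (p.obj e))
      (h e _ (terminal.from (p.obj e))).choose_spec.choose⟩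

/-- The cocartesian arrow from `e` to its reindexing along `p e ⟶ ⊤_ A`. -/
noncomputable def reflUnit (e : E) : e ⟶ (incl p).obj (h.reflObj e) :=
  (h e _ (terminal.from (p.obj e))).choose_spec.choose

instance reflUnit_cocartesian (e : E) :
    p.IsStronglyCocartesian (terminal.from (p.obj e)) (h.reflUnit e) :=
  (h e _ (terminal.from (p.obj e))).choose_spec.choose_spec

lemma isHomLift_terminal {e e' : E} (b : A) (hb : p.obj e = b) (he : p.obj e' = ⊤_ A)
    (f : e ⟶ e') : p.IsHomLift (terminal.from b) f :=
  IsHomLift.of_fac _ _ _ hb he (Subsingleton.elim _ _)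

/-- The arrow out of the reindexing of `e` along `p e ⟶ ⊤_ A` given by its universal property. -/
noncomputable def reflDesc {e : E} {Y : TermFiber p} (f : e ⟶ (incl p).obj Y) :
    h.reflObj e ⟶ Y :=
  have : p.IsHomLift (terminal.from (p.obj e)) f := isHomLift_terminal _ rfl Y.2 f
  ⟨IsCocartesian.map (b' := (incl p).obj Y) p (terminal.from (p.obj e)) (h.reflUnit e) f,
    IsCocartesian.map_isHomLift p (terminal.from (p.obj e)) (h.reflUnit e) f⟩

@[simp]
lemma reflUnit_reflDesc {e : E} {Y : TermFiber p} (f : e ⟶ (incl p).obj Y) :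
    h.reflUnit e ≫ (incl p).map (h.reflDesc f) = f :=
  have : p.IsHomLift (terminal.from (p.obj e)) f := isHomLift_terminal _ rfl Y.2 f
  IsCocartesian.fac (b' := (incl p).obj Y) p (terminal.from (p.obj e)) (h.reflUnit e) f

@[simp]
lemma reflUnit_reflDesc_assoc {e : E} {Y : TermFiber p} (f : e ⟶ (incl p).obj Y) {z : E}
    (k : (incl p).obj Y ⟶ z) : h.reflUnit e ≫ (incl p).map (h.reflDesc f) ≫ k = f ≫ k := by
  rw [← Category.assoc, reflUnit_reflDesc]

lemma refl_ext {e : E} {Y : TermFiber p} {f g : h.reflObj e ⟶ Y}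
    (w : h.reflUnit e ≫ (incl p).map f = h.reflUnit e ≫ (incl p).map g) : f = g :=
  Fiber.hom_ext (IsCocartesian.ext p (terminal.from (p.obj e)) (h.reflUnit e) _ _ w)

/-- The universal property of the reindexing along `p e ⟶ ⊤_ A`. -/
noncomputable def reflEquiv (e : E) (Y : TermFiber p) :
    (h.reflObj e ⟶ Y) ≃ (e ⟶ (incl p).obj Y) where
  toFun g := h.reflUnit e ≫ (incl p).map g
  invFun f := h.reflDesc f
  left_inv g := h.refl_ext (by simp)
  right_inv f := by simp

/-- The reflector of the total category onto the terminal fibre. -/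
noncomputable def refl : E ⥤ TermFiber p :=
  Adjunction.leftAdjointOfEquiv (G := incl p) h.reflEquiv (fun _ _ _ _ _ => by
    simp [reflEquiv])

/-- The terminal fibre is reflective. -/
noncomputable def reflAdj : h.refl ⊣ incl p :=
  Adjunction.adjunctionOfEquivLeft h.reflEquiv (fun _ _ _ _ _ => by simp [reflEquiv])

/-- The cocartesian arrow from `e` to its reflection. -/
noncomputable def unit (e : E) : e ⟶ (incl p).obj (h.refl.obj e) := h.reflUnit e

instance unit_cocartesian (e : E) :
    p.IsStronglyCocartesian (terminal.from (p.obj e)) (h.unit e) :=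
  h.reflUnit_cocartesian e

/-- The arrow out of the reflection of `e` given by its universal property. -/
noncomputable def desc {e : E} {Y : TermFiber p} (f : e ⟶ (incl p).obj Y) : h.refl.obj e ⟶ Y :=
  h.reflDesc f

@[simp]
lemma unit_desc {e : E} {Y : TermFiber p} (f : e ⟶ (incl p).obj Y) :
    h.unit e ≫ (incl p).map (h.desc f) = f :=
  h.reflUnit_reflDesc f

lemma unit_ext {e : E} {Y : TermFiber p} {f g : h.refl.obj e ⟶ Y}
    (w : h.unit e ≫ (incl p).map f = h.unit e ≫ (incl p).map g) : f = g :=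
  h.refl_ext w

@[simp]
lemma unit_nat {e e' : E} (f : e ⟶ e') :
    h.unit e ≫ (incl p).map (h.refl.map f) = f ≫ h.unit e' :=
  (h.reflUnit_reflDesc _).trans (by simp [reflEquiv]; rfl)

@[simp]
lemma unit_nat_assoc {e e' : E} (f : e ⟶ e') {z : E}
    (k : (incl p).obj (h.refl.obj e') ⟶ z) :
    h.unit e ≫ (incl p).map (h.refl.map f) ≫ k = f ≫ h.unit e' ≫ k := by
  rw [← Category.assoc, unit_nat, Category.assoc]

end IsOpfibration

namespace IsPruned

variable [HasTerminal A] {p : E ⥤ A} (h : IsPruned p)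

/-- The fully faithful right adjoint of a pruned opfibration. -/
noncomputable def right : A ⥤ E := h.exists_rightAdjoint.choose

/-- The adjunction between a pruned opfibration and its right adjoint. -/
noncomputable def adj : p ⊣ h.right := h.exists_rightAdjoint.choose_spec.choose

lemma right_full : h.right.Full := h.exists_rightAdjoint.choose_spec.choose_spec.1

lemma right_faithful : h.right.Faithful := h.exists_rightAdjoint.choose_spec.choose_spec.2.1

instance hasProd (a : A) (Y : TermFiber p) :
    HasBinaryProduct (h.right.obj a) ((incl p).obj Y) :=
  (h.exists_rightAdjoint.choose_spec.choose_spec.2.2 a Y).1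

instance preservesProd (a : A) (Y : TermFiber p) :
    PreservesLimit (pair (h.right.obj a) ((incl p).obj Y)) p :=
  (h.exists_rightAdjoint.choose_spec.choose_spec.2.2 a Y).2

/-- The reflector of the total category onto the terminal fibre. -/
noncomputable abbrev refl : E ⥤ TermFiber p := h.isOpfibration.refl

/-- The terminal fibre is reflective. -/
noncomputable abbrev reflAdj : h.refl ⊣ incl p := h.isOpfibration.reflAdj

/-- The cocartesian arrow from `e` to its reflection. -/
noncomputable abbrev unit (e : E) : e ⟶ (incl p).obj (h.refl.obj e) := h.isOpfibration.unit e

/-- The arrow out of the reflection of `e` given by its universal property. -/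
noncomputable abbrev desc {e : E} {Y : TermFiber p} (f : e ⟶ (incl p).obj Y) :
    h.refl.obj e ⟶ Y := h.isOpfibration.desc f

/-- The product `r a × Y`, for `r` the right adjoint of `p`. -/
noncomputable def prodObj (a : A) (Y : TermFiber p) : E :=
  (h.right.obj a) ⨯ ((incl p).obj Y)

/-- The first projection of `r a × Y`. -/
noncomputable def fst (a : A) (Y : TermFiber p) : h.prodObj a Y ⟶ h.right.obj a :=
  prod.fst

/-- The second projection of `r a × Y`. -/
noncomputable def snd (a : A) (Y : TermFiber p) : h.prodObj a Y ⟶ (incl p).obj Y :=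
  prod.snd

/-- The first projection of `r a × Y`, transposed to an arrow in the base. -/
noncomputable def proj (a : A) (Y : TermFiber p) : p.obj (h.prodObj a Y) ⟶ a :=
  (h.adj.homEquiv _ _).symm (h.fst a Y)

/-- The arrow into `r a × Y` with the given components, the first one transposed. -/
noncomputable def pair {e : E} {a : A} {Y : TermFiber p} (f : p.obj e ⟶ a)
    (g : e ⟶ (incl p).obj Y) : e ⟶ h.prodObj a Y :=
  prod.lift (h.adj.homEquiv _ _ f) g

/-- The arrow `r f × g`. -/
noncomputable def prodMap {a b : A} {Y Z : TermFiber p} (f : a ⟶ b) (g : Y ⟶ Z) :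
    h.prodObj a Y ⟶ h.prodObj b Z :=
  prod.map (h.right.map f) ((incl p).map g)

lemma pair_fst {e : E} {a : A} {Y : TermFiber p} (f : p.obj e ⟶ a)
    (g : e ⟶ (incl p).obj Y) : h.pair f g ≫ h.fst a Y = h.adj.homEquiv _ _ f :=
  prod.lift_fst _ _

@[simp]
lemma pair_proj {e : E} {a : A} {Y : TermFiber p} (f : p.obj e ⟶ a)
    (g : e ⟶ (incl p).obj Y) : p.map (h.pair f g) ≫ h.proj a Y = f := by
  rw [proj, ← Adjunction.homEquiv_naturality_left_symm, pair_fst, Equiv.symm_apply_apply]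

@[simp]
lemma pair_proj_assoc {e : E} {a : A} {Y : TermFiber p} (f : p.obj e ⟶ a)
    (g : e ⟶ (incl p).obj Y) {b : A} (k : a ⟶ b) :
    p.map (h.pair f g) ≫ h.proj a Y ≫ k = f ≫ k := by
  rw [← Category.assoc, pair_proj]

@[simp]
lemma pair_snd {e : E} {a : A} {Y : TermFiber p} (f : p.obj e ⟶ a)
    (g : e ⟶ (incl p).obj Y) : h.pair f g ≫ h.snd a Y = g :=
  prod.lift_snd _ _

@[simp]
lemma pair_snd_assoc {e : E} {a : A} {Y : TermFiber p} (f : p.obj e ⟶ a)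
    (g : e ⟶ (incl p).obj Y) {z : E} (k : (incl p).obj Y ⟶ z) :
    h.pair f g ≫ h.snd a Y ≫ k = g ≫ k := by
  rw [← Category.assoc, pair_snd]

lemma pair_ext {e : E} {a : A} {Y : TermFiber p} {f g : e ⟶ h.prodObj a Y}
    (h₁ : p.map f ≫ h.proj a Y = p.map g ≫ h.proj a Y)
    (h₂ : f ≫ h.snd a Y = g ≫ h.snd a Y) : f = g := by
  apply Limits.prod.hom_ext
  · rw [proj, ← Adjunction.homEquiv_naturality_left_symm,
      ← Adjunction.homEquiv_naturality_left_symm] at h₁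
    exact (h.adj.homEquiv _ _).symm.injective h₁
  · exact h₂

@[simp]
lemma prodMap_proj {a b : A} {Y Z : TermFiber p} (f : a ⟶ b) (g : Y ⟶ Z) :
    p.map (h.prodMap f g) ≫ h.proj b Z = h.proj a Y ≫ f := by
  rw [proj, proj, ← Adjunction.homEquiv_naturality_left_symm,
    ← Adjunction.homEquiv_naturality_right_symm]
  congr 1
  exact prod.map_fst _ _

@[simp]
lemma prodMap_proj_assoc {a b : A} {Y Z : TermFiber p} (f : a ⟶ b) (g : Y ⟶ Z) {c : A}
    (k : b ⟶ c) :
    p.map (h.prodMap f g) ≫ h.proj b Z ≫ k = h.proj a Y ≫ f ≫ k := by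
  rw [← Category.assoc, prodMap_proj, Category.assoc]

@[simp]
lemma prodMap_snd {a b : A} {Y Z : TermFiber p} (f : a ⟶ b) (g : Y ⟶ Z) :
    h.prodMap f g ≫ h.snd b Z = h.snd a Y ≫ (incl p).map g :=
  prod.map_snd _ _

@[simp]
lemma prodMap_snd_assoc {a b : A} {Y Z : TermFiber p} (f : a ⟶ b) (g : Y ⟶ Z) {z : E}
    (k : (incl p).obj Z ⟶ z) :
    h.prodMap f g ≫ h.snd b Z ≫ k = h.snd a Y ≫ (incl p).map g ≫ k := by
  rw [← Category.assoc, prodMap_snd, Category.assoc]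

/-- The functor sending `(a, Y)` to the product `r a × Y`. -/
noncomputable def prodFunctor : A × TermFiber p ⥤ E where
  obj x := h.prodObj x.1 x.2
  map f := h.prodMap f.1 f.2
  map_id x := h.pair_ext (by simp) (by simp)
  map_comp f g := h.pair_ext (by simp) (by simp)

/-- The bijection defining the adjunction between `⟨p, refl⟩` and `(a, Y) ↦ r a × Y`. -/
noncomputable def prodEquiv (e : E) (x : A × TermFiber p) :
    ((p.prod' h.refl).obj e ⟶ x) ≃ (e ⟶ h.prodFunctor.obj x) where
  toFun f := h.pair f.1 (h.unit e ≫ (incl p).map f.2)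
  invFun g := (p.map g ≫ h.proj x.1 x.2, h.desc (g ≫ h.snd x.1 x.2))
  left_inv f := Prod.ext (h.pair_proj _ _) (h.isOpfibration.unit_ext
    ((h.isOpfibration.unit_desc _).trans (h.pair_snd _ _)))
  right_inv g := h.pair_ext (h.pair_proj _ _)
    ((h.pair_snd _ _).trans (h.isOpfibration.unit_desc _))

/-- The adjunction between `⟨p, refl⟩` and `(a, Y) ↦ r a × Y`. -/
noncomputable def prodAdj : p.prod' h.refl ⊣ h.prodFunctor :=
  Adjunction.mkOfHomEquiv
    { homEquiv := h.prodEquiv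
      homEquiv_naturality_left_symm := fun {e e' x} f (g : e' ⟶ h.prodObj x.1 x.2) => by
        apply Prod.ext
        · change p.map (f ≫ g) ≫ h.proj x.1 x.2 = p.map f ≫ p.map g ≫ h.proj x.1 x.2
          rw [Functor.map_comp, Category.assoc]
        · change h.desc ((f ≫ g) ≫ h.snd x.1 x.2) = h.refl.map f ≫ h.desc (g ≫ h.snd x.1 x.2)
          apply h.isOpfibration.unit_ext
          simp
      homEquiv_naturality_right := fun {e x x'} f g => by
        obtain ⟨f₁, f₂⟩ := f
        obtain ⟨g₁, g₂⟩ := g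
        change h.pair (f₁ ≫ g₁) (h.unit e ≫ (incl p).map (f₂ ≫ g₂)) =
          h.pair f₁ (h.unit e ≫ (incl p).map f₂) ≫ h.prodMap g₁ g₂
        apply h.pair_ext <;> simp }

end IsPruned

end Opfibrations

/-! ### Comonads on a product -/

section Slices

variable {A : Type u₁} [Category.{v₁} A] {X : Type u} [Category.{v} X]

namespace Slice

variable (W : Comonad (A × X))

/-- The second component of the object part of `W`. -/
def ob (a : A) (Y : X) : X := (W.obj (a, Y)).2

/-- The second component of the action of `W` on arrows. -/
def mp {a b : A} {Y Z : X} (f : a ⟶ b) (g : Y ⟶ Z) : ob W a Y ⟶ ob W b Z :=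
  (W.map (X := (a, Y)) (Y := (b, Z)) (f, g)).2

/-- The first component of the object part of `W`. -/
def obBase (a : A) (Y : X) : A := (W.obj (a, Y)).1

/-- The first component of the action of `W` on arrows. -/
def mpBase {a b : A} {Y Z : X} (f : a ⟶ b) (g : Y ⟶ Z) : obBase W a Y ⟶ obBase W b Z :=
  (W.map (X := (a, Y)) (Y := (b, Z)) (f, g)).1

/-- The first component of the counit of `W`. -/
def counitBase (a : A) (Y : X) : obBase W a Y ⟶ a := (W.ε.app (a, Y)).1

/-- The second component of the counit of `W`. -/
def counit (a : A) (Y : X) : ob W a Y ⟶ Y := (W.ε.app (a, Y)).2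

/-- The first component of the comultiplication of `W`. -/
def comultBase (a : A) (Y : X) : obBase W a Y ⟶ obBase W (obBase W a Y) (ob W a Y) :=
  (W.δ.app (a, Y)).1

/-- The second component of the comultiplication of `W`. -/
def comult (a : A) (Y : X) : ob W a Y ⟶ ob W (obBase W a Y) (ob W a Y) :=
  (W.δ.app (a, Y)).2

lemma mp_id (a : A) (Y : X) : mp W (𝟙 a) (𝟙 Y) = 𝟙 _ :=
  congrArg Prod.snd (W.map_id (a, Y))

lemma mp_comp {a b c : A} {Y Z V : X} (f : a ⟶ b) (f' : b ⟶ c) (g : Y ⟶ Z) (g' : Z ⟶ V) :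
    mp W f g ≫ mp W f' g' = mp W (f ≫ f') (g ≫ g') :=
  (congrArg Prod.snd
    (W.map_comp (X := (a, Y)) (Y := (b, Z)) (Z := (c, V)) (f, g) (f', g'))).symm

lemma counit_nat {a b : A} {Y Z : X} (f : a ⟶ b) (g : Y ⟶ Z) :
    mp W f g ≫ counit W b Z = counit W a Y ≫ g :=
  congrArg Prod.snd (W.ε.naturality (X := (a, Y)) (Y := (b, Z)) (f, g))

lemma counitBase_nat {a b : A} {Y Z : X} (f : a ⟶ b) (g : Y ⟶ Z) :
    mpBase W f g ≫ counitBase W b Z = counitBase W a Y ≫ f :=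
  congrArg Prod.fst (W.ε.naturality (X := (a, Y)) (Y := (b, Z)) (f, g))

lemma comult_nat {a b : A} {Y Z : X} (f : a ⟶ b) (g : Y ⟶ Z) :
    mp W f g ≫ comult W b Z = comult W a Y ≫ mp W (mpBase W f g) (mp W f g) :=
  congrArg Prod.snd (W.δ.naturality (X := (a, Y)) (Y := (b, Z)) (f, g))

lemma comult_counit (a : A) (Y : X) :
    comult W a Y ≫ counit W (obBase W a Y) (ob W a Y) = 𝟙 _ :=
  congrArg Prod.snd (W.left_counit (a, Y))

lemma comultBase_counitBase (a : A) (Y : X) :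
    comultBase W a Y ≫ counitBase W (obBase W a Y) (ob W a Y) = 𝟙 _ :=
  congrArg Prod.fst (W.left_counit (a, Y))

lemma comult_mp_counit (a : A) (Y : X) :
    comult W a Y ≫ mp W (counitBase W a Y) (counit W a Y) = 𝟙 _ :=
  congrArg Prod.snd (W.right_counit (a, Y))

lemma comult_assoc (a : A) (Y : X) :
    comult W a Y ≫ mp W (comultBase W a Y) (comult W a Y) =
      comult W a Y ≫ comult W (obBase W a Y) (ob W a Y) :=
  congrArg Prod.snd (W.coassoc (a, Y))

/-- The comultiplication of the comonad on `X` over `a`. -/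
def sliceComult (a : A) (Y : X) : ob W a Y ⟶ ob W a (ob W a Y) :=
  comult W a Y ≫ mp W (counitBase W a Y) (𝟙 _)

lemma sliceComult_nat {a b : A} {Y Z : X} (f : a ⟶ b) (g : Y ⟶ Z) :
    mp W f g ≫ sliceComult W b Z = sliceComult W a Y ≫ mp W f (mp W f g) := by
  simp only [sliceComult, Category.assoc]
  rw [← Category.assoc, comult_nat, Category.assoc, mp_comp, mp_comp, counitBase_nat,
    Category.comp_id, Category.id_comp]

lemma sliceComult_assoc (a : A) (Y : X) :
    sliceComult W a Y ≫ mp W (𝟙 a) (sliceComult W a Y) =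
      sliceComult W a Y ≫ sliceComult W a (ob W a Y) := by
  conv_rhs => rw [sliceComult, Category.assoc, sliceComult_nat, sliceComult, ← Category.assoc,
    ← Category.assoc, ← comult_assoc, Category.assoc, Category.assoc, mp_comp, mp_comp,
    ← Category.assoc (comultBase W a Y), comultBase_counitBase, Category.id_comp]
  simp only [sliceComult, Category.assoc, mp_comp, Category.comp_id, Category.id_comp]

end Slice

open Slice

/-- A comonad `W` on `A × X`, with counit `(k, e)`, restricts to a comonad on `X` for each `a`:
its functor is the second component of `W (a, -)`, its counit is the second component of the counit,
and its comultiplication is the second component of the comultiplication of `W`, followed by the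
action of `k`. -/
@[simps]
def sliceComonad (W : Comonad (A × X)) (a : A) : Comonad X where
  obj Y := ob W a Y
  map g := mp W (𝟙 a) g
  map_id Y := mp_id W a Y
  map_comp g g' := by rw [mp_comp, Category.comp_id]
  ε := { app := fun Y => counit W a Y
         naturality := fun Y Z g => counit_nat W (𝟙 a) g }
  δ := { app := fun Y => sliceComult W a Y
         naturality := fun Y Z g => sliceComult_nat W (𝟙 a) g }
  coassoc Y := sliceComult_assoc W a Y
  left_counit Y := by
    change sliceComult W a Y ≫ counit W a (ob W a Y) = 𝟙 _
    rw [sliceComult, Category.assoc, counit_nat, Category.comp_id, comult_counit]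
  right_counit Y := by
    change sliceComult W a Y ≫ mp W (𝟙 a) (counit W a Y) = 𝟙 _
    rw [sliceComult, Category.assoc, mp_comp, Category.comp_id, Category.id_comp,
      comult_mp_counit]

/-- The parametrized comonad on `X` obtained from a comonad on `A × X`. -/
def paramComonadOf (W : Comonad (A × X)) : A ⥤ Comonad X where
  obj a := sliceComonad W a
  map {a b} f :=
    { app := fun Y => mp W f (𝟙 Y)
      naturality := fun Y Z g => by
        change mp W (𝟙 a) g ≫ mp W f (𝟙 Z) = mp W f (𝟙 Y) ≫ mp W (𝟙 b) g
        simp [mp_comp]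
      app_ε := fun Y => (counit_nat W f (𝟙 Y)).trans (Category.comp_id _)
      app_δ := fun Y => by
        change mp W f (𝟙 Y) ≫ sliceComult W b Y =
          sliceComult W a Y ≫ mp W f (𝟙 _) ≫ mp W (𝟙 b) (mp W f (𝟙 Y))
        rw [sliceComult_nat, mp_comp, Category.comp_id, Category.id_comp] }
  map_id a := by
    ext Y
    exact mp_id W a Y
  map_comp f g := by
    ext Y
    change mp W (f ≫ g) (𝟙 Y) = mp W f (𝟙 Y) ≫ mp W g (𝟙 Y)
    rw [mp_comp, Category.comp_id]

end Slices

/-! ### Parametrized comonads -/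

/-- A parametrized comonad over `A`: a category of carriers `X`, together with a functor from `A`
to the category of comonads on `X` and comonad morphisms. -/
structure ParamComonad (A : Type u₁) [Category.{v₁} A] where
  carrier : Type u
  [category : Category.{v} carrier]
  comonad : A ⥤ Comonad carrier

attribute [instance] ParamComonad.category

namespace ParamComonad

variable {A : Type u₁} [Category.{v₁} A]

section Total

variable (S : ParamComonad.{v₁, u₁, v, u} A)

/-- An object of the category of coalgebras of a parametrized comonad `S`: an object `base` of `A`
and a coalgebra for the comonad `S_base`. -/
structure Total where
  base : A
  coalg : (S.comonad.obj base).Coalgebra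

variable {S}

/-- A morphism `(a, X, ξ) ⟶ (b, Y, θ)` is a pair of `base : a ⟶ b` and `carrier : X ⟶ Y`, the
latter a morphism of `S_b`-coalgebras from the pushforward of `(X, ξ)` along `base`. -/
@[ext]
structure Total.Hom (M N : Total S) where
  base : M.base ⟶ N.base
  carrier : M.coalg.A ⟶ N.coalg.A
  comm : (M.coalg.a ≫ (S.comonad.map base).app M.coalg.A) ≫ (S.comonad.obj N.base).map carrier =
    carrier ≫ N.coalg.a

lemma map_app_comp {a b c : A} (f : a ⟶ b) (g : b ⟶ c) (Y : S.carrier) :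
    (S.comonad.map (f ≫ g)).app Y = (S.comonad.map f).app Y ≫ (S.comonad.map g).app Y := by
  rw [S.comonad.map_comp]; rfl

lemma map_app_id (a : A) (Y : S.carrier) : (S.comonad.map (𝟙 a)).app Y = 𝟙 _ := by
  rw [S.comonad.map_id]; rfl

lemma map_app_naturality {a b : A} (f : a ⟶ b) {Y Z : S.carrier} (g : Y ⟶ Z) :
    (S.comonad.obj a).map g ≫ (S.comonad.map f).app Z =
      (S.comonad.map f).app Y ≫ (S.comonad.obj b).map g :=
  (S.comonad.map f).naturality g

lemma map_app_naturality_assoc {a b : A} (f : a ⟶ b) {Y Z : S.carrier} (g : Y ⟶ Z)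
    {V : S.carrier} (k : (S.comonad.obj b).obj Z ⟶ V) :
    (S.comonad.obj a).map g ≫ (S.comonad.map f).app Z ≫ k =
      (S.comonad.map f).app Y ≫ (S.comonad.obj b).map g ≫ k := by
  rw [← Category.assoc, map_app_naturality, Category.assoc]

instance : Category (Total S) where
  Hom := Total.Hom
  id M :=
    { base := 𝟙 _
      carrier := 𝟙 _
      comm := by rw [map_app_id]; simp }
  comp {M N P} f g :=
    { base := f.base ≫ g.base
      carrier := f.carrier ≫ g.carrier
      comm := by
        rw [map_app_comp, Functor.map_comp]
        simp only [Category.assoc]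
        have hf := f.comm
        have hg := g.comm
        simp only [Category.assoc] at hf hg
        rw [← map_app_naturality_assoc, reassoc_of% hf, hg] }

@[ext]
lemma Total.hom_ext {M N : Total S} {f g : M ⟶ N} (h : f.base = g.base)
    (h' : f.carrier = g.carrier) : f = g := Total.Hom.ext h h'

@[simp] lemma Total.id_base (M : Total S) : Total.Hom.base (𝟙 M) = 𝟙 _ := rfl
@[simp] lemma Total.id_carrier (M : Total S) : Total.Hom.carrier (𝟙 M) = 𝟙 _ := rfl
@[simp] lemma Total.comp_base {M N P : Total S} (f : M ⟶ N) (g : N ⟶ P) :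
    (f ≫ g).base = f.base ≫ g.base := rfl
@[simp] lemma Total.comp_carrier {M N P : Total S} (f : M ⟶ N) (g : N ⟶ P) :
    (f ≫ g).carrier = f.carrier ≫ g.carrier := rfl

variable (S) in
/-- The coEilenberg-Moore opfibration of a parametrized comonad. -/
def proj : Total S ⥤ A where
  obj M := M.base
  map f := f.base

end Total

/-! ### The 2-category of parametrized comonads over `A` -/

/-- A morphism of parametrized comonads over `A`: a functor between the categories of carriers,
together with a family `V (S_a Y) ⟶ T_a (V Y)`, natural in `a` and `Y`, and compatible with the
counits and the comultiplications. -/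
@[ext]
structure Hom (S T : ParamComonad.{v₁, u₁, v, u} A) where
  functor : S.carrier ⥤ T.carrier
  dist (a : A) (Y : S.carrier) :
    functor.obj ((S.comonad.obj a).obj Y) ⟶ (T.comonad.obj a).obj (functor.obj Y)
  naturality (a : A) {Y Z : S.carrier} (g : Y ⟶ Z) :
    functor.map ((S.comonad.obj a).map g) ≫ dist a Z =
      dist a Y ≫ (T.comonad.obj a).map (functor.map g)
  naturality_base {a b : A} (f : a ⟶ b) (Y : S.carrier) :
    functor.map ((S.comonad.map f).app Y) ≫ dist b Y =
      dist a Y ≫ (T.comonad.map f).app (functor.obj Y)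
  counit (a : A) (Y : S.carrier) :
    dist a Y ≫ (T.comonad.obj a).ε.app (functor.obj Y) =
      functor.map ((S.comonad.obj a).ε.app Y)
  comult (a : A) (Y : S.carrier) :
    dist a Y ≫ (T.comonad.obj a).δ.app (functor.obj Y) =
      functor.map ((S.comonad.obj a).δ.app Y) ≫ dist a ((S.comonad.obj a).obj Y) ≫
        (T.comonad.obj a).map (dist a Y)

/-- A 2-cell between morphisms of parametrized comonads over `A`. -/
@[ext]
structure Hom₂ {S T : ParamComonad.{v₁, u₁, v, u} A} (F G : Hom S T) where
  trans : F.functor ⟶ G.functor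
  comm (a : A) (Y : S.carrier) :
    F.dist a Y ≫ (T.comonad.obj a).map (trans.app Y) =
      trans.app ((S.comonad.obj a).obj Y) ≫ G.dist a Y

instance {S T : ParamComonad.{v₁, u₁, v, u} A} : Category (Hom S T) where
  Hom := Hom₂
  id F := { trans := 𝟙 _, comm := fun a Y => by simp }
  comp {F G H} α β :=
    { trans := α.trans ≫ β.trans
      comm := fun a Y => by
        simp only [NatTrans.comp_app, Functor.map_comp, Category.assoc]
        rw [reassoc_of% (α.comm a Y), β.comm] }

section

variable {S T : ParamComonad.{v₁, u₁, v, u} A}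

@[ext]
lemma hom₂_ext {F G : Hom S T} {α β : F ⟶ G} (h : ∀ Y, α.trans.app Y = β.trans.app Y) : α = β :=
  Hom₂.ext (NatTrans.ext (funext h))

@[simp] lemma id_trans_app (F : Hom S T) (Y : S.carrier) :
    NatTrans.app (Hom₂.trans (𝟙 F)) Y = 𝟙 _ := rfl
@[simp] lemma comp_trans_app {F G H : Hom S T} (α : F ⟶ G) (β : G ⟶ H) (Y : S.carrier) :
    (α ≫ β).trans.app Y = α.trans.app Y ≫ β.trans.app Y := rfl

/-- An invertible 2-cell from an invertible natural transformation. -/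
@[simps]
def isoMk {F G : Hom S T} (e : F.functor ≅ G.functor)
    (h : ∀ (a : A) (Y : S.carrier), F.dist a Y ≫ (T.comonad.obj a).map (e.hom.app Y) =
      e.hom.app ((S.comonad.obj a).obj Y) ≫ G.dist a Y) : F ≅ G where
  hom := { trans := e.hom, comm := h }
  inv :=
    { trans := e.inv
      comm := fun a Y => by
        have := h a Y
        rw [← cancel_epi (e.hom.app _), ← Category.assoc, ← this, Category.assoc,
          ← Functor.map_comp]
        simp }
  hom_inv_id := by ext Y; simp
  inv_hom_id := by ext Y; simp

end

/-- The identity morphism of a parametrized comonad. -/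
@[simps]
def Hom.id (S : ParamComonad.{v₁, u₁, v, u} A) : Hom S S where
  functor := 𝟭 _
  dist a Y := 𝟙 _
  naturality a Y Z g := by simp
  naturality_base f Y := by simp
  counit a Y := by simp
  comult a Y := by simp

/-- The composition of morphisms of parametrized comonads. -/
@[simps]
def Hom.comp {S T U : ParamComonad.{v₁, u₁, v, u} A} (F : Hom S T) (G : Hom T U) : Hom S U where
  functor := F.functor ⋙ G.functor
  dist a Y := G.functor.map (F.dist a Y) ≫ G.dist a (F.functor.obj Y)
  naturality a Y Z g := by
    simp only [Functor.comp_map, Category.assoc]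
    rw [← Functor.map_comp_assoc, F.naturality, Functor.map_comp_assoc, G.naturality]
  naturality_base f Y := by
    simp only [Functor.comp_map, Category.assoc, Functor.comp_obj]
    rw [← Functor.map_comp_assoc, F.naturality_base, Functor.map_comp_assoc, G.naturality_base]
  counit a Y := by
    simp only [Functor.comp_map, Category.assoc, Functor.comp_obj]
    rw [G.counit, ← Functor.map_comp, F.counit]
  comult a Y := by
    simp only [Functor.comp_map, Category.assoc, Functor.comp_obj]
    rw [G.comult, ← Functor.map_comp_assoc, F.comult]
    simp only [Functor.map_comp, Category.assoc]
    rw [reassoc_of% (G.naturality a (F.dist a Y))]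

/-- Whiskering on the left. -/
@[simps]
def Hom₂.whiskerLeft {S T U : ParamComonad.{v₁, u₁, v, u} A} (F : Hom S T) {G H : Hom T U}
    (α : Hom₂ G H) : Hom₂ (F.comp G) (F.comp H) where
  trans := Functor.whiskerLeft F.functor α.trans
  comm a Y := by
    change (G.functor.map (F.dist a Y) ≫ G.dist a (F.functor.obj Y)) ≫
        (U.comonad.obj a).map (α.trans.app (F.functor.obj Y)) =
      α.trans.app (F.functor.obj ((S.comonad.obj a).obj Y)) ≫
        H.functor.map (F.dist a Y) ≫ H.dist a (F.functor.obj Y)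
    rw [Category.assoc, α.comm, α.trans.naturality_assoc]

/-- Whiskering on the right. -/
@[simps]
def Hom₂.whiskerRight {S T U : ParamComonad.{v₁, u₁, v, u} A} {F G : Hom S T} (α : Hom₂ F G)
    (H : Hom T U) : Hom₂ (F.comp H) (G.comp H) where
  trans := Functor.whiskerRight α.trans H.functor
  comm a Y := by
    change (H.functor.map (F.dist a Y) ≫ H.dist a (F.functor.obj Y)) ≫
        (U.comonad.obj a).map (H.functor.map (α.trans.app Y)) =
      H.functor.map (α.trans.app ((S.comonad.obj a).obj Y)) ≫
        H.functor.map (G.dist a Y) ≫ H.dist a (G.functor.obj Y)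
    rw [Category.assoc, ← H.naturality, ← Functor.map_comp_assoc, α.comm,
      Functor.map_comp_assoc]

/-- The associator. -/
def Hom.assoc {S T U V : ParamComonad.{v₁, u₁, v, u} A} (F : Hom S T) (G : Hom T U) (H : Hom U V) :
    (F.comp G).comp H ≅ F.comp (G.comp H) :=
  isoMk (F := (F.comp G).comp H) (G := F.comp (G.comp H)) (Functor.associator _ _ _)
    (fun a Y => by
      change (H.functor.map (G.functor.map (F.dist a Y) ≫ G.dist a (F.functor.obj Y)) ≫
          H.dist a (G.functor.obj (F.functor.obj Y))) ≫ (V.comonad.obj a).map (𝟙 _) =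
        𝟙 _ ≫ H.functor.map (G.functor.map (F.dist a Y)) ≫
          H.functor.map (G.dist a (F.functor.obj Y)) ≫
            H.dist a (G.functor.obj (F.functor.obj Y))
      simp)

/-- The left unitor. -/
def Hom.leftUnit {S T : ParamComonad.{v₁, u₁, v, u} A} (F : Hom S T) : (Hom.id S).comp F ≅ F :=
  isoMk (F := (Hom.id S).comp F) (G := F) (Functor.leftUnitor _) (fun a Y => by
    change (F.functor.map (𝟙 _) ≫ F.dist a Y) ≫ (T.comonad.obj a).map (𝟙 _) = 𝟙 _ ≫ F.dist a Y
    simp)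

/-- The right unitor. -/
def Hom.rightUnit {S T : ParamComonad.{v₁, u₁, v, u} A} (F : Hom S T) : F.comp (Hom.id T) ≅ F :=
  isoMk (F := F.comp (Hom.id T)) (G := F) (Functor.rightUnitor _) (fun a Y => by
    change (F.dist a Y ≫ 𝟙 _) ≫ (T.comonad.obj a).map (𝟙 _) = 𝟙 _ ≫ F.dist a Y
    simp)

instance bicategory : Bicategory (ParamComonad.{v₁, u₁, v, u} A) where
  Hom := Hom
  id := Hom.id
  comp F G := Hom.comp F G
  whiskerLeft F _ _ α := Hom₂.whiskerLeft F α
  whiskerRight α H := Hom₂.whiskerRight α H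
  associator F G H := Hom.assoc F G H
  leftUnitor F := Hom.leftUnit F
  rightUnitor F := Hom.rightUnit F
  whiskerLeft_id F G := by
    ext Y; rfl
  whiskerLeft_comp F _ _ _ α β := by
    ext Y; rfl
  id_whiskerLeft {S T F G} α := by
    ext Y
    change α.trans.app Y = 𝟙 _ ≫ α.trans.app Y ≫ 𝟙 _
    simp
  comp_whiskerLeft F G _ _ α := by
    ext Y
    change α.trans.app _ = 𝟙 _ ≫ α.trans.app _ ≫ 𝟙 _
    simp
  id_whiskerRight F G := by
    ext Y; exact G.functor.map_id _
  comp_whiskerRight α β G := by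
    ext Y; exact G.functor.map_comp _ _
  whiskerRight_id {S T F G} α := by
    ext Y
    change α.trans.app Y = 𝟙 _ ≫ α.trans.app Y ≫ 𝟙 _
    simp
  whiskerRight_comp {_ _ _ _ F F'} α G H := by
    ext Y
    change H.functor.map (G.functor.map (α.trans.app Y)) =
      𝟙 _ ≫ H.functor.map (G.functor.map (α.trans.app Y)) ≫ 𝟙 _
    simp
  whisker_assoc F _ _ α H := by
    ext Y
    change H.functor.map (α.trans.app _) = 𝟙 _ ≫ H.functor.map (α.trans.app _) ≫ 𝟙 _
    simp
  whisker_exchange α β := by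
    ext Y; exact (β.trans.naturality _).symm
  pentagon F G H I := by
    ext Y
    change I.functor.map (𝟙 _) ≫ 𝟙 _ ≫ 𝟙 _ = 𝟙 _ ≫ 𝟙 _
    simp
  triangle F G := by
    ext Y
    change 𝟙 _ ≫ 𝟙 _ = G.functor.map (𝟙 _)
    simp

end ParamComonad

/-- A pruned parametrized comonad over `A`: the category of carriers has a terminal object and the
comonad at the terminal object of `A` is isomorphic, as a functor, to the identity. -/
structure PrunedComonad (A : Type u₁) [Category.{v₁} A] [HasTerminal A] extends
    ParamComonad.{v₁, u₁, v, u} A where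
  hasTerminal : HasTerminal carrier
  nonempty_iso : Nonempty ((comonad.obj (⊤_ A)).toFunctor ≅ 𝟭 carrier)

/-- The full sub-2-category of pruned parametrized comonads. -/
instance PrunedComonad.bicategory (A : Type u₁) [Category.{v₁} A] [HasTerminal A] :
    Bicategory (PrunedComonad.{v₁, u₁, v, u} A) where
  Hom S T := S.toParamComonad ⟶ T.toParamComonad
  id S := 𝟙 S.toParamComonad
  comp F G := CategoryStruct.comp (obj := ParamComonad A) F G
  homCategory S T := inferInstanceAs (Category (S.toParamComonad ⟶ T.toParamComonad))
  whiskerLeft F _ _ α := Bicategory.whiskerLeft (B := ParamComonad A) F α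
  whiskerRight α H := Bicategory.whiskerRight (B := ParamComonad A) α H
  associator F G H := Bicategory.associator (B := ParamComonad A) F G H
  leftUnitor F := Bicategory.leftUnitor (B := ParamComonad A) F
  rightUnitor F := Bicategory.rightUnitor (B := ParamComonad A) F
  whiskerLeft_id F G := Bicategory.whiskerLeft_id (B := ParamComonad A) F G
  whiskerLeft_comp F _ _ _ α β := Bicategory.whiskerLeft_comp (B := ParamComonad A) F α β
  id_whiskerLeft α := Bicategory.id_whiskerLeft (B := ParamComonad A) α
  comp_whiskerLeft F G _ _ α := Bicategory.comp_whiskerLeft (B := ParamComonad A) F G α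
  id_whiskerRight F G := Bicategory.id_whiskerRight (B := ParamComonad A) F G
  comp_whiskerRight α β G := Bicategory.comp_whiskerRight (B := ParamComonad A) α β G
  whiskerRight_id α := Bicategory.whiskerRight_id (B := ParamComonad A) α
  whiskerRight_comp α G H := Bicategory.whiskerRight_comp (B := ParamComonad A) α G H
  whisker_assoc F _ _ α H := Bicategory.whisker_assoc (B := ParamComonad A) F α H
  whisker_exchange α β := Bicategory.whisker_exchange (B := ParamComonad A) α β
  pentagon F G H I := Bicategory.pentagon (B := ParamComonad A) F G H I
  triangle F G := Bicategory.triangle (B := ParamComonad A) F G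

/-! ### The 2-category of pruned opfibrations -/

/-- A pruned opfibration over `A`. -/
structure PrunedOpfib (A : Type u₁) [Category.{v₁} A] [HasTerminal A] extends
    BasedCategory.{v, u} A where
  isPruned : IsPruned p

namespace PrunedOpfib

variable {A : Type u₁} [Category.{v₁} A] [HasTerminal A]

/-- A morphism of pruned opfibrations over `A`: a functor over `A` between the total categories
that preserves cocartesian arrows. -/
@[ext]
structure Hom (P Q : PrunedOpfib.{v₁, u₁, v, u} A) where
  based : P.toBasedCategory ⥤ᵇ Q.toBasedCategory
  cocartesian {e e' : P.obj} {a b : A} (f : a ⟶ b) (φ : e ⟶ e') :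
    P.p.IsStronglyCocartesian f φ → Q.p.IsStronglyCocartesian f (based.map φ)

instance (P Q : PrunedOpfib.{v₁, u₁, v, u} A) : Category (Hom P Q) where
  Hom F G := F.based ⟶ G.based
  id F := 𝟙 F.based
  comp α β := CategoryStruct.comp (obj := P.toBasedCategory ⥤ᵇ Q.toBasedCategory) α β
  id_comp α := Category.id_comp (obj := P.toBasedCategory ⥤ᵇ Q.toBasedCategory) α
  comp_id α := Category.comp_id (obj := P.toBasedCategory ⥤ᵇ Q.toBasedCategory) α
  assoc α β γ := Category.assoc (obj := P.toBasedCategory ⥤ᵇ Q.toBasedCategory) α β γ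

/-- The identity morphism. -/
def Hom.id (P : PrunedOpfib.{v₁, u₁, v, u} A) : Hom P P where
  based := BasedFunctor.id _
  cocartesian _ _ h := h

/-- The composition of morphisms. -/
def Hom.comp {P Q R : PrunedOpfib.{v₁, u₁, v, u} A} (F : Hom P Q) (G : Hom Q R) : Hom P R where
  based := F.based.comp G.based
  cocartesian f φ h := G.cocartesian f _ (F.cocartesian f φ h)

/-- An isomorphism of based functors gives an invertible 2-cell. -/
def isoMk {P Q : PrunedOpfib.{v₁, u₁, v, u} A} {F G : Hom P Q} (e : F.based ≅ G.based) :
    F ≅ G where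
  hom := e.hom
  inv := e.inv
  hom_inv_id := e.hom_inv_id
  inv_hom_id := e.inv_hom_id

/-- The 2-category of pruned opfibrations over `A`: morphisms are the functors over `A` preserving
cocartesian arrows, and 2-cells are the vertical natural transformations. -/
instance bicategory : Bicategory (PrunedOpfib.{v₁, u₁, v, u} A) where
  Hom := Hom
  id := Hom.id
  comp F G := Hom.comp F G
  whiskerLeft F _ _ α := BasedCategory.whiskerLeft F.based α
  whiskerRight α H := BasedCategory.whiskerRight α H.based
  associator F G H := isoMk (F := (F.comp G).comp H) (G := F.comp (G.comp H)) (Iso.refl _)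
  leftUnitor {P Q} F := isoMk (F := (Hom.id P).comp F) (G := F) (Iso.refl _)
  rightUnitor {P Q} F := isoMk (F := F.comp (Hom.id Q)) (G := F) (Iso.refl _)
  whiskerLeft_id F G := Bicategory.whiskerLeft_id (B := BasedCategory A) F.based G.based
  whiskerLeft_comp F _ _ _ α β :=
    Bicategory.whiskerLeft_comp (B := BasedCategory A) F.based α β
  id_whiskerLeft α := Bicategory.id_whiskerLeft (B := BasedCategory A) α
  comp_whiskerLeft F G _ _ α :=
    Bicategory.comp_whiskerLeft (B := BasedCategory A) F.based G.based α
  id_whiskerRight F G := Bicategory.id_whiskerRight (B := BasedCategory A) F.based G.based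
  comp_whiskerRight α β G := Bicategory.comp_whiskerRight (B := BasedCategory A) α β G.based
  whiskerRight_id α := Bicategory.whiskerRight_id (B := BasedCategory A) α
  whiskerRight_comp α G H :=
    Bicategory.whiskerRight_comp (B := BasedCategory A) α G.based H.based
  whisker_assoc F _ _ α H := Bicategory.whisker_assoc (B := BasedCategory A) F.based α H.based
  whisker_exchange α β := Bicategory.whisker_exchange (B := BasedCategory A) α β
  pentagon F G H I := Bicategory.pentagon (B := BasedCategory A) F.based G.based H.based I.based
  triangle F G := Bicategory.triangle (B := BasedCategory A) F.based G.based

/-- The component of a 2-cell. -/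
def app {P Q : PrunedOpfib.{v₁, u₁, v, u} A} {F G : P ⟶ Q} (α : F ⟶ G) (e : P.obj) :
    (Hom.based F).obj e ⟶ (Hom.based G).obj e :=
  NatTrans.app (BasedNatTrans.toNatTrans α) e

lemma hom₂_ext {P Q : PrunedOpfib.{v₁, u₁, v, u} A} {F G : P ⟶ Q} {α β : F ⟶ G}
    (h : ∀ e, app α e = app β e) : α = β :=
  BasedNatTrans.ext _ _ (NatTrans.ext (funext h))

end PrunedOpfib

/-! ### The coEilenberg-Moore opfibration -/

namespace ParamComonad

variable {A : Type u₁} [Category.{v₁} A]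

section

variable (S : ParamComonad.{v₁, u₁, v, u} A)

variable {S}

/-- The pushforward of a coalgebra along an arrow of the base. -/
abbrev Total.push (M : Total S) {b : A} (f : M.base ⟶ b) : Total S where
  base := b
  coalg :=
    { A := M.coalg.A
      a := M.coalg.a ≫ (S.comonad.map f).app M.coalg.A
      counit := by
        rw [Category.assoc, ComonadHom.app_ε, M.coalg.counit]
      coassoc := by
        rw [Category.assoc, ComonadHom.app_δ, M.coalg.coassoc_assoc, Functor.map_comp,
          Category.assoc, map_app_naturality_assoc] }

/-- The cocartesian lift of an arrow of the base. -/
def Total.pushHom (M : Total S) {b : A} (f : M.base ⟶ b) : M ⟶ M.push f where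
  base := f
  carrier := 𝟙 M.coalg.A
  comm := by
    change (M.coalg.a ≫ (S.comonad.map f).app M.coalg.A) ≫ (S.comonad.obj b).map (𝟙 M.coalg.A) =
      𝟙 M.coalg.A ≫ M.coalg.a ≫ (S.comonad.map f).app M.coalg.A
    rw [CategoryTheory.Functor.map_id, Category.comp_id, Category.id_comp]

variable (S) in
/-- The functor sending a coalgebra to its carrier. -/
@[simps]
def forget : Total S ⥤ S.carrier where
  obj M := M.coalg.A
  map f := f.carrier

lemma base_of_isHomLift {M N : Total S} (φ : M ⟶ N) (f : (proj S).obj M ⟶ (proj S).obj N)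
    (_ : (proj S).IsHomLift f φ) : φ.base = f :=
  (IsHomLift.eq_of_isHomLift (proj S) f φ).symm

lemma isHomLift_base {M N : Total S} (φ : M ⟶ N) : (proj S).IsHomLift φ.base φ :=
  CategoryTheory.IsHomLift.map (proj S) φ

/-- An arrow of coalgebras whose underlying arrow of carriers is invertible is cocartesian. -/
lemma cocartesian_of_isIso {M N : Total S} (φ : M ⟶ N) [IsIso φ.carrier] {a b : A} (f : a ⟶ b)
    [hf : (proj S).IsHomLift f φ] : (proj S).IsStronglyCocartesian f φ := by
  obtain rfl : a = M.base := (IsHomLift.domain_eq (proj S) f φ).symm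
  obtain rfl : b = N.base := (IsHomLift.codomain_eq (proj S) f φ).symm
  obtain rfl := base_of_isHomLift φ f hf
  refine @IsStronglyCocartesian.mk _ _ _ _ _ _ _ _ _ _ _ hf ?_
  intro N' (g : N.base ⟶ N'.base) ψ hψ
  have hb : ψ.base = φ.base ≫ g := base_of_isHomLift ψ _ hψ
  have hφ := φ.comm
  have hψ' := ψ.comm
  rw [Category.assoc] at hφ hψ'
  let χ : N ⟶ N' :=
    { base := g
      carrier := inv φ.carrier ≫ ψ.carrier
      comm := by
        rw [← cancel_epi φ.carrier, Category.assoc, Category.assoc, IsIso.hom_inv_id_assoc,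
          ← reassoc_of% hφ, ← hψ', hb, map_app_comp, Category.assoc,
          map_app_naturality_assoc g φ.carrier, ← CategoryTheory.Functor.map_comp,
          IsIso.hom_inv_id_assoc] }
  have hχ : (proj S).IsHomLift g χ := isHomLift_base χ
  refine ⟨χ, ⟨hχ, Total.hom_ext hb.symm (IsIso.hom_inv_id_assoc _ _)⟩, ?_⟩
  rintro χ' ⟨hχ', e⟩
  apply Total.hom_ext
  · exact base_of_isHomLift χ' g hχ'
  · rw [← cancel_epi φ.carrier]
    exact (congrArg Total.Hom.carrier e).trans (IsIso.hom_inv_id_assoc _ _).symm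

instance Total.pushHom_cocartesian (M : Total S) {b : A} (f : M.base ⟶ b) :
    (proj S).IsStronglyCocartesian f (M.pushHom f) :=
  have : (proj S).IsHomLift f (M.pushHom f) := isHomLift_base (M.pushHom f)
  have : IsIso (M.pushHom f).carrier := inferInstanceAs (IsIso (𝟙 M.coalg.A))
  cocartesian_of_isIso _ _

variable (S) in
lemma isOpfibration_proj : IsOpfibration (proj S) := fun M _ f =>
  ⟨M.push f, M.pushHom f, M.pushHom_cocartesian f⟩

/-- A cocartesian arrow of coalgebras is invertible on carriers. -/
lemma isIso_of_cocartesian {M N : Total S} (φ : M ⟶ N) {a b : A} (f : a ⟶ b)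
    (hf : (proj S).IsStronglyCocartesian f φ) : IsIso φ.carrier := by
  obtain rfl : a = M.base := (IsHomLift.domain_eq (proj S) f φ).symm
  obtain rfl : b = N.base := (IsHomLift.codomain_eq (proj S) f φ).symm
  let e := IsCocartesian.codomainUniqueUpToIso (proj S) f φ (M.pushHom f)
  have h : φ ≫ e.hom = M.pushHom f := IsCocartesian.fac (proj S) f φ (M.pushHom f)
  have h' : φ.carrier ≫ e.hom.carrier = 𝟙 M.coalg.A := congrArg Total.Hom.carrier h
  have : IsIso e.hom.carrier := inferInstanceAs (IsIso ((forget S).map e.hom))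
  exact IsIso.of_isIso_fac_right h'

/-! ### The right adjoint of the coEilenberg-Moore opfibration -/

variable (S) in
/-- The cofree coalgebra over `a` on `Y`. -/
abbrev cofree (a : A) (Y : S.carrier) : Total S where
  base := a
  coalg := { A := (S.comonad.obj a).obj Y, a := (S.comonad.obj a).δ.app Y }

/-- The arrow into a cofree coalgebra with the given components. -/
def cofreeLift {M : Total S} {a : A} {Y : S.carrier} (f : M.base ⟶ a) (g : M.coalg.A ⟶ Y) :
    M ⟶ S.cofree a Y where
  base := f
  carrier := M.coalg.a ≫ (S.comonad.map f).app _ ≫ (S.comonad.obj a).map g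
  comm := by
    change (M.coalg.a ≫ (S.comonad.map f).app M.coalg.A) ≫ (S.comonad.obj a).map
        (M.coalg.a ≫ (S.comonad.map f).app _ ≫ (S.comonad.obj a).map g) =
      (M.coalg.a ≫ (S.comonad.map f).app _ ≫ (S.comonad.obj a).map g) ≫
        (S.comonad.obj a).δ.app Y
    simp only [Category.assoc, Comonad.delta_naturality, ComonadHom.app_δ_assoc,
      M.coalg.coassoc_assoc, Functor.map_comp, map_app_naturality_assoc]

lemma cofreeLift_counit {M : Total S} {a : A} {Y : S.carrier} (f : M.base ⟶ a)
    (g : M.coalg.A ⟶ Y) :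
    (cofreeLift f g).carrier ≫ (S.comonad.obj a).ε.app Y = g := by
  change (M.coalg.a ≫ (S.comonad.map f).app _ ≫ (S.comonad.obj a).map g) ≫
    (S.comonad.obj a).ε.app Y = g
  rw [Category.assoc, Category.assoc, Comonad.counit_naturality, ComonadHom.app_ε_assoc,
    M.coalg.counit_assoc]

lemma cofree_ext {M : Total S} {a : A} {Y : S.carrier} {φ ψ : M ⟶ S.cofree a Y}
    (h₁ : φ.base = ψ.base)
    (h₂ : φ.carrier ≫ (S.comonad.obj a).ε.app Y = ψ.carrier ≫ (S.comonad.obj a).ε.app Y) :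
    φ = ψ := by
  have key (χ : M ⟶ S.cofree a Y) : χ.carrier =
      M.coalg.a ≫ (S.comonad.map χ.base).app _ ≫
        (S.comonad.obj a).map (χ.carrier ≫ (S.comonad.obj a).ε.app Y) := by
    have h := χ.comm
    change (M.coalg.a ≫ (S.comonad.map χ.base).app M.coalg.A) ≫
      (S.comonad.obj a).map χ.carrier = χ.carrier ≫ (S.comonad.obj a).δ.app Y at h
    change χ.carrier = M.coalg.a ≫ (S.comonad.map χ.base).app M.coalg.A ≫
      (S.comonad.obj a).map (χ.carrier ≫ (S.comonad.obj a).ε.app Y)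
    rw [CategoryTheory.Functor.map_comp, ← Category.assoc, ← Category.assoc, h, Category.assoc,
      Comonad.right_counit, Category.comp_id]
  apply Total.hom_ext h₁
  rw [key φ, key ψ, h₁, h₂]

variable [HasTerminal S.carrier]

variable (S) in
/-- The functor sending `a` to the cofree coalgebra over `a` on the terminal object. -/
noncomputable def cofreeTerminal : A ⥤ Total S where
  obj a := S.cofree a (⊤_ S.carrier)
  map {a b} f := cofreeLift (M := S.cofree a (⊤_ S.carrier)) f (terminal.from _)
  map_id a := cofree_ext rfl (terminal.hom_ext _ _)
  map_comp f g := cofree_ext rfl (terminal.hom_ext _ _)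

variable (S) in
/-- The coEilenberg-Moore opfibration has a right adjoint. -/
noncomputable def cofreeTerminalAdj : proj S ⊣ S.cofreeTerminal :=
  Adjunction.mkOfHomEquiv
    { homEquiv := fun M a =>
        { toFun := fun f => cofreeLift f (terminal.from _)
          invFun := fun φ => φ.base
          left_inv := fun _ => rfl
          right_inv := fun _ => cofree_ext rfl (terminal.hom_ext _ _) }
      homEquiv_naturality_left_symm := fun _ _ => rfl
      homEquiv_naturality_right := fun _ _ => cofree_ext rfl (terminal.hom_ext _ _) }

end

/-- The counit of a comonad isomorphic to the identity functor is invertible. -/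
lemma isIso_counit {X : Type u} [Category.{v} X] (G : Comonad X) (e : G.toFunctor ≅ 𝟭 X) (Y : X) :
    IsIso (G.ε.app Y) := by
  let z : 𝟭 X ⟶ 𝟭 X := e.inv ≫ G.ε
  have hz (Y : X) : G.ε.app Y = e.hom.app Y ≫ z.app Y := by simp [z]
  have h1 (Y : X) : IsIso (G.ε.app (G.obj Y)) := by
    have h := G.left_counit Y
    rw [hz, ← Category.assoc] at h
    have h' : z.app (G.obj Y) ≫ G.δ.app Y ≫ e.hom.app (G.obj Y) = 𝟙 _ :=
      (z.naturality (G.δ.app Y ≫ e.hom.app (G.obj Y))).symm.trans h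
    have : IsIso (z.app (G.obj Y)) := ⟨_, h', h⟩
    rw [hz]
    infer_instance
  have h2 := G.ε.naturality (e.hom.app Y)
  have h3 : G.ε.app Y = inv (G.map (e.hom.app Y)) ≫ G.ε.app (G.obj Y) ≫ e.hom.app Y := by
    rw [IsIso.eq_inv_comp]
    exact h2
  rw [h3]
  have := h1 Y
  infer_instance

end ParamComonad

namespace PrunedComonad

open ParamComonad

variable {A : Type u₁} [Category.{v₁} A] [HasTerminal A] (S : PrunedComonad.{v₁, u₁, v, u} A)

instance (Y : S.carrier) : IsIso ((S.comonad.obj (⊤_ A)).ε.app Y) :=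
  isIso_counit _ S.nonempty_iso.some Y

instance : HasTerminal S.carrier := S.hasTerminal

/-- The second projection of the product of a cofree coalgebra with a coalgebra over the terminal
object. -/
noncomputable def cofreeSnd (a : A) (M : Total S.toParamComonad) (hM : M.base = ⊤_ A) :
    S.cofree a M.coalg.A ⟶ M where
  base := terminal.from a ≫ eqToHom hM.symm
  carrier := (S.comonad.obj a).ε.app M.coalg.A
  comm := by
    obtain ⟨b, N⟩ := M
    change b = ⊤_ A at hM
    subst hM
    rw [eqToHom_refl, Category.comp_id]
    change ((S.comonad.obj a).δ.app N.A ≫ (S.comonad.map _).app _) ≫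
      (S.comonad.obj (⊤_ A)).map ((S.comonad.obj a).ε.app N.A) = (S.comonad.obj a).ε.app N.A ≫ N.a
    rw [← cancel_mono ((S.comonad.obj (⊤_ A)).ε.app N.A)]
    have h : (S.comonad.obj (⊤_ A)).map ((S.comonad.obj a).ε.app N.A :
        (S.comonad.obj a).obj N.A ⟶ N.A) ≫ (S.comonad.obj (⊤_ A)).ε.app N.A =
        (S.comonad.obj (⊤_ A)).ε.app ((S.comonad.obj a).obj N.A) ≫
          ((S.comonad.obj a).ε.app N.A : (S.comonad.obj a).obj N.A ⟶ N.A) :=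
      (S.comonad.obj (⊤_ A)).ε.naturality _
    rw [Category.assoc, Category.assoc, Category.assoc, N.counit, h, ComonadHom.app_ε_assoc,
      Comonad.left_counit_assoc]
    exact (Category.comp_id _).symm

/-- The product of a cofree coalgebra on the terminal object with a coalgebra over the terminal
object. -/
noncomputable def prodFan (a : A) (M : Total S.toParamComonad) (hM : M.base = ⊤_ A) :
    BinaryFan (S.cofreeTerminal.obj a) M :=
  BinaryFan.mk (P := S.cofree a M.coalg.A)
    (cofreeLift (M := S.cofree a M.coalg.A) (a := a) (𝟙 a) (terminal.from _))
    (S.cofreeSnd a M hM)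

lemma hom_base_ext {M N : Total S.toParamComonad} (hN : N.base = ⊤_ A) (f g : M.base ⟶ N.base) :
    f = g := by
  obtain ⟨b, N⟩ := N
  obtain rfl := hN
  exact Subsingleton.elim (α := M.base ⟶ ⊤_ A) f g

/-- The product of a cofree coalgebra on the terminal object with a coalgebra over the terminal
object is a product. -/
noncomputable def prodFanIsLimit (a : A) (M : Total S.toParamComonad) (hM : M.base = ⊤_ A) :
    IsLimit (S.prodFan a M hM) :=
  BinaryFan.isLimitMk
    (fun s => cofreeLift (a := a) (Y := M.coalg.A) s.fst.base s.snd.carrier)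
    (fun s => cofree_ext (Category.comp_id _) (terminal.hom_ext _ _))
    (fun s => Total.hom_ext (S.hom_base_ext hM _ _) (cofreeLift_counit _ _))
    (fun s m h₁ h₂ => cofree_ext
      ((Category.comp_id _).symm.trans (congrArg Total.Hom.base h₁))
      ((congrArg Total.Hom.carrier h₂).trans (cofreeLift_counit _ _).symm))

lemma isPruned_proj : IsPruned (proj S.toParamComonad) where
  isOpfibration := isOpfibration_proj _
  exists_rightAdjoint := by
    have : IsIso (S.cofreeTerminalAdj).counit := by
      have (a : A) : IsIso ((S.cofreeTerminalAdj).counit.app a) := by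
        have h : (S.cofreeTerminalAdj).counit.app a = 𝟙 a := rfl
        rw [h]
        exact inferInstanceAs (IsIso (𝟙 a))
      exact NatIso.isIso_of_isIso_app _
    refine ⟨S.cofreeTerminal, S.cofreeTerminalAdj, ?_, ?_, fun a Y => ⟨?_, ?_⟩⟩
    · exact S.cofreeTerminalAdj.fullyFaithfulROfIsIsoCounit.full
    · exact S.cofreeTerminalAdj.fullyFaithfulROfIsIsoCounit.faithful
    · exact ⟨_, S.prodFanIsLimit a _ Y.2⟩
    · refine preservesLimit_of_preserves_limit_cone (S.prodFanIsLimit a _ Y.2)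
        ((isLimitMapConeBinaryFanEquiv _ _ _).symm ?_)
      refine BinaryFan.isLimitMk (fun s => s.fst) (fun s => Category.comp_id _)
        (fun s => ?_) (fun s m h₁ _ => (Category.comp_id _).symm.trans h₁)
      have hY (x : A) (f g : x ⟶ (proj S.toParamComonad).obj ((incl _).obj Y)) : f = g := by
        have e : (proj S.toParamComonad).obj ((incl (proj S.toParamComonad)).obj Y) = ⊤_ A := Y.2
        rw [← cancel_mono (eqToHom e)]
        exact terminal.hom_ext _ _
      exact hY _ _ _

end PrunedComonad

/-! ### The coEilenberg-Moore 2-functor -/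

namespace ParamComonad

variable {A : Type u₁} [Category.{v₁} A] {S T : ParamComonad.{v₁, u₁, v, u} A}

/-- The action on coalgebras of a morphism of parametrized comonads. -/
abbrev Hom.mapObj (F : Hom S T) (M : Total S) : Total T where
  base := M.base
  coalg :=
    { A := F.functor.obj M.coalg.A
      a := F.functor.map M.coalg.a ≫ F.dist M.base M.coalg.A
      counit := by
        rw [Category.assoc, F.counit, ← CategoryTheory.Functor.map_comp, M.coalg.counit]
        exact F.functor.map_id _
      coassoc := by
        rw [Category.assoc, F.comult, ← Functor.map_comp_assoc, M.coalg.coassoc,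
          Functor.map_comp_assoc, CategoryTheory.Functor.map_comp,
          reassoc_of% (F.naturality M.base M.coalg.a), Category.assoc] }

/-- The functor between categories of coalgebras induced by a morphism of parametrized comonads. -/
def Hom.mapTotal (F : Hom S T) : Total S ⥤ Total T where
  obj M := F.mapObj M
  map {M N} φ :=
    { base := φ.base
      carrier := F.functor.map φ.carrier
      comm := by
        change ((F.functor.map M.coalg.a ≫ F.dist M.base M.coalg.A) ≫
          (T.comonad.map φ.base).app (F.functor.obj M.coalg.A)) ≫
            (T.comonad.obj N.base).map (F.functor.map φ.carrier) =
          F.functor.map φ.carrier ≫ F.functor.map N.coalg.a ≫ F.dist N.base N.coalg.A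
        rw [← Functor.map_comp_assoc, ← φ.comm, Functor.map_comp_assoc,
          CategoryTheory.Functor.map_comp, F.naturality]
        simp only [Category.assoc]
        rw [reassoc_of% (F.naturality_base φ.base M.coalg.A)] }
  map_id M := Total.hom_ext rfl (F.functor.map_id _)
  map_comp φ ψ := Total.hom_ext rfl (F.functor.map_comp _ _)

lemma Hom.mapTotal_cocartesian (F : Hom S T) {M N : Total S} {a b : A} (f : a ⟶ b) (φ : M ⟶ N)
    (h : (proj S).IsStronglyCocartesian f φ) :
    (proj T).IsStronglyCocartesian f (F.mapTotal.map φ) := by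
  obtain rfl : a = M.base := (IsHomLift.domain_eq (proj S) f φ).symm
  obtain rfl : b = N.base := (IsHomLift.codomain_eq (proj S) f φ).symm
  obtain rfl := base_of_isHomLift φ f h.toIsHomLift
  have : IsIso φ.carrier := isIso_of_cocartesian φ _ h
  have : IsIso (F.mapTotal.map φ).carrier := inferInstanceAs (IsIso (F.functor.map φ.carrier))
  have : (proj T).IsHomLift φ.base (F.mapTotal.map φ) := isHomLift_base (F.mapTotal.map φ)
  exact cocartesian_of_isIso _ _

/-- An isomorphism of coalgebras over the same object of the base. -/
@[simps]
def Total.vertIso {b : A} {M N : (T.comonad.obj b).Coalgebra} (e : M.A ≅ N.A)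
    (h : M.a ≫ (T.comonad.obj b).map e.hom = e.hom ≫ N.a) :
    (⟨b, M⟩ : Total T) ≅ ⟨b, N⟩ where
  hom :=
    { base := 𝟙 b
      carrier := e.hom
      comm := by
        change (M.a ≫ (T.comonad.map (𝟙 b)).app M.A) ≫ (T.comonad.obj b).map e.hom = e.hom ≫ N.a
        rw [map_app_id, Category.comp_id, h] }
  inv :=
    { base := 𝟙 b
      carrier := e.inv
      comm := by
        change (N.a ≫ (T.comonad.map (𝟙 b)).app N.A) ≫ (T.comonad.obj b).map e.inv = e.inv ≫ M.a
        rw [map_app_id, Category.comp_id, ← cancel_epi e.hom, ← Category.assoc, ← h,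
          Category.assoc, ← CategoryTheory.Functor.map_comp]
        simp }
  hom_inv_id := Total.hom_ext (Category.comp_id _) e.hom_inv_id
  inv_hom_id := Total.hom_ext (Category.comp_id _) e.inv_hom_id

/-- The natural transformation induced by a 2-cell. -/
def Hom₂.mapTotal {F G : Hom S T} (α : Hom₂ F G) : F.mapTotal ⟶ G.mapTotal where
  app M :=
    { base := 𝟙 M.base
      carrier := α.trans.app M.coalg.A
      comm := by
        change ((F.functor.map M.coalg.a ≫ F.dist M.base M.coalg.A) ≫
          (T.comonad.map (𝟙 M.base)).app (F.functor.obj M.coalg.A)) ≫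
            (T.comonad.obj M.base).map (α.trans.app M.coalg.A) =
          α.trans.app M.coalg.A ≫ G.functor.map M.coalg.a ≫ G.dist M.base M.coalg.A
        rw [map_app_id, Category.comp_id, Category.assoc, α.comm, α.trans.naturality_assoc] }
  naturality M N φ := by
    apply Total.hom_ext
    · change φ.base ≫ 𝟙 N.base = 𝟙 M.base ≫ φ.base
      simp
    · exact α.trans.naturality φ.carrier

variable (S) in
/-- The functor induced by the identity is isomorphic to the identity. -/
def mapTotalId : (Hom.id S).mapTotal ≅ CategoryTheory.Functor.id (Total S) :=
  NatIso.ofComponents (F := (Hom.id S).mapTotal) (G := CategoryTheory.Functor.id (Total S))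
    (fun M => Total.vertIso (M := ((Hom.id S).mapObj M).coalg) (N := M.coalg) (Iso.refl _)
      (by
        change (M.coalg.a ≫ 𝟙 _) ≫ (S.comonad.obj M.base).map (𝟙 _) = 𝟙 _ ≫ M.coalg.a
        simp))
    (fun {M N} φ => Total.hom_ext
      ((Category.comp_id φ.base).trans (Category.id_comp φ.base).symm)
      ((Category.comp_id φ.carrier).trans (Category.id_comp φ.carrier).symm))

variable (S) in
lemma isHomLift_mapTotalId (M : Total S) :
    (proj S).IsHomLift (𝟙 M.base) ((mapTotalId S).hom.app M) :=
  isHomLift_base (S := S) ((mapTotalId S).hom.app M)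

/-- The functor induced by a composite is isomorphic to the composite of the induced functors. -/
def mapTotalComp {U : ParamComonad.{v₁, u₁, v, u} A} (F : Hom S T) (G : Hom T U) :
    (F.comp G).mapTotal ≅ CategoryTheory.Functor.comp F.mapTotal G.mapTotal :=
  NatIso.ofComponents (F := (F.comp G).mapTotal)
    (G := CategoryTheory.Functor.comp F.mapTotal G.mapTotal)
    (fun M => Total.vertIso (M := ((F.comp G).mapObj M).coalg)
      (N := (G.mapObj (F.mapObj M)).coalg) (Iso.refl _)
      (by
        change (G.functor.map (F.functor.map M.coalg.a) ≫
            G.functor.map (F.dist M.base M.coalg.A) ≫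
              G.dist M.base (F.functor.obj M.coalg.A)) ≫
                (U.comonad.obj M.base).map (𝟙 _) =
          𝟙 _ ≫ G.functor.map (F.functor.map M.coalg.a ≫ F.dist M.base M.coalg.A) ≫
            G.dist M.base (F.functor.obj M.coalg.A)
        simp))
    (fun {M N} φ => Total.hom_ext
      ((Category.comp_id φ.base).trans (Category.id_comp φ.base).symm)
      ((Category.comp_id (G.functor.map (F.functor.map φ.carrier))).trans
        (Category.id_comp (G.functor.map (F.functor.map φ.carrier))).symm))

lemma isHomLift_mapTotalComp {U : ParamComonad.{v₁, u₁, v, u} A} (F : Hom S T) (G : Hom T U)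
    (M : Total S) : (proj U).IsHomLift (𝟙 M.base) ((mapTotalComp F G).hom.app M) :=
  isHomLift_base (S := U) ((mapTotalComp F G).hom.app M)

end ParamComonad

section

open ParamComonad

variable {A : Type u₁} [Category.{v₁} A] [HasTerminal A]

namespace PrunedComonad

/-- The coEilenberg-Moore opfibration of a pruned parametrized comonad. -/
abbrev toOpfib (S : PrunedComonad.{v₁, u₁, v, u} A) :
    PrunedOpfib.{v₁, u₁, max v₁ v, max u₁ u v} A where
  obj := Total S.toParamComonad
  p := ParamComonad.proj S.toParamComonad
  isPruned := isPruned_proj S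

/-- The morphism of coEilenberg-Moore opfibrations induced by a morphism of pruned comonads. -/
abbrev mapOpfib {S T : PrunedComonad.{v₁, u₁, v, u} A} (F : S ⟶ T) :
    PrunedOpfib.Hom (toOpfib S) (toOpfib T) where
  based :=
    { toFunctor := ParamComonad.Hom.mapTotal F
      w := rfl }
  cocartesian f φ h := ParamComonad.Hom.mapTotal_cocartesian F f φ h

/-- The 2-cell between morphisms of coEilenberg-Moore opfibrations induced by a 2-cell. -/
def map₂Opfib {S T : PrunedComonad.{v₁, u₁, v, u} A} {F G : S ⟶ T} (α : F ⟶ G) :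
    mapOpfib F ⟶ mapOpfib G where
  toNatTrans := ParamComonad.Hom₂.mapTotal α
  isHomLift' M := isHomLift_base (NatTrans.app (ParamComonad.Hom₂.mapTotal α) M)

/-- The action on identities. -/
def mapOpfibId (S : PrunedComonad.{v₁, u₁, v, u} A) :
    mapOpfib (𝟙 S) ≅ PrunedOpfib.Hom.id (toOpfib S) :=
  PrunedOpfib.isoMk (BasedNatIso.mkNatIso (mapTotalId S.toParamComonad)
    (isHomLift_mapTotalId S.toParamComonad))

/-- The action on compositions. -/
def mapOpfibComp {S T U : PrunedComonad.{v₁, u₁, v, u} A} (F : S ⟶ T) (G : T ⟶ U) :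
    mapOpfib (F ≫ G) ≅ PrunedOpfib.Hom.comp (mapOpfib F) (mapOpfib G) :=
  PrunedOpfib.isoMk (BasedNatIso.mkNatIso (mapTotalComp F G) (isHomLift_mapTotalComp F G))

/-- The coEilenberg-Moore pseudofunctor, from pruned parametrized comonads to pruned opfibrations. -/
def coEM (A : Type u₁) [Category.{v₁} A] [HasTerminal A] :
    Pseudofunctor (PrunedComonad.{v₁, u₁, v, u} A)
      (PrunedOpfib.{v₁, u₁, max v₁ v, max u₁ u v} A) where
  obj S := toOpfib S
  map F := mapOpfib F
  map₂ α := map₂Opfib α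
  map₂_id F := PrunedOpfib.hom₂_ext fun M => Total.hom_ext rfl rfl
  map₂_comp α β := PrunedOpfib.hom₂_ext fun M => Total.hom_ext (Category.comp_id _).symm rfl
  mapId S := mapOpfibId S
  mapComp F G := mapOpfibComp F G
  map₂_whisker_left {S T U} F {G H} α := PrunedOpfib.hom₂_ext fun M => Total.hom_ext
    (by
      change 𝟙 M.base = 𝟙 M.base ≫ 𝟙 M.base ≫ 𝟙 M.base
      simp)
    (by
      change α.trans.app (F.functor.obj M.coalg.A) =
        𝟙 _ ≫ α.trans.app (F.functor.obj M.coalg.A) ≫ 𝟙 _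
      simp)
  map₂_whisker_right {S T U F G} α H := PrunedOpfib.hom₂_ext fun M => Total.hom_ext
    (by
      change 𝟙 M.base = 𝟙 M.base ≫ 𝟙 M.base ≫ 𝟙 M.base
      simp)
    (by
      change H.functor.map (α.trans.app M.coalg.A) =
        𝟙 _ ≫ H.functor.map (α.trans.app M.coalg.A) ≫ 𝟙 _
      simp)
  map₂_associator {S T U V} F G H := PrunedOpfib.hom₂_ext fun M => Total.hom_ext
    (by
      change 𝟙 M.base = 𝟙 M.base ≫ 𝟙 M.base ≫ 𝟙 M.base ≫ 𝟙 M.base ≫ 𝟙 M.base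
      simp)
    (by
      change 𝟙 (H.functor.obj (G.functor.obj (F.functor.obj M.coalg.A))) =
        𝟙 _ ≫ H.functor.map (𝟙 _) ≫ 𝟙 _ ≫ 𝟙 _ ≫ 𝟙 _
      simp)
  map₂_left_unitor {S T} F := PrunedOpfib.hom₂_ext fun M => Total.hom_ext
    (by
      change 𝟙 M.base = 𝟙 M.base ≫ 𝟙 M.base ≫ 𝟙 M.base
      simp)
    (by
      change 𝟙 (F.functor.obj M.coalg.A) = 𝟙 _ ≫ F.functor.map (𝟙 _) ≫ 𝟙 _
      simp)
  map₂_right_unitor {S T} F := PrunedOpfib.hom₂_ext fun M => Total.hom_ext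
    (by
      change 𝟙 M.base = 𝟙 M.base ≫ 𝟙 M.base ≫ 𝟙 M.base
      simp)
    (by
      change 𝟙 (F.functor.obj M.coalg.A) = 𝟙 _ ≫ 𝟙 _ ≫ 𝟙 _
      simp)

end PrunedComonad

end

/-! ### The parametrized comonad of a pruned opfibration -/

section

variable {A : Type u₁} [Category.{v₁} A] [HasTerminal A] {E : Type u} [Category.{v} E]
  {p : E ⥤ A}

/-- The terminal fibre is a full subcategory. -/
noncomputable def fibHom {Y Z : TermFiber p} (f : (incl p).obj Y ⟶ (incl p).obj Z) : Y ⟶ Z :=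
  ⟨f, IsHomLift.of_fac _ _ _ Y.2 Z.2 (terminal.hom_ext _ _)⟩

@[simp]
lemma incl_map_fibHom {Y Z : TermFiber p} (f : (incl p).obj Y ⟶ (incl p).obj Z) :
    (incl p).map (fibHom f) = f := rfl

lemma fib_ext {Y Z : TermFiber p} {f g : Y ⟶ Z} (h : (incl p).map f = (incl p).map g) : f = g :=
  Fiber.hom_ext h

lemma isHomLift_of_cocartesian {e : E} {Y Z : TermFiber p} {a : A} {u : e ⟶ (incl p).obj Y}
    (hu : p.IsStronglyCocartesian (terminal.from a) u) (f : e ⟶ (incl p).obj Z) :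
    p.IsHomLift (terminal.from a) f :=
  IsOpfibration.isHomLift_terminal a (IsHomLift.domain_eq p (terminal.from a) u) Z.2 f

/-- The arrow in the terminal fibre induced by the universal property of a cocartesian arrow. -/
noncomputable def fibDesc {e : E} {Y Z : TermFiber p} {a : A} {u : e ⟶ (incl p).obj Y}
    (hu : p.IsStronglyCocartesian (terminal.from a) u) (f : e ⟶ (incl p).obj Z) : Y ⟶ Z :=
  have : p.IsHomLift (terminal.from a) f := isHomLift_of_cocartesian hu f
  fibHom (IsCocartesian.map (b' := (incl p).obj Z) p (terminal.from a) u f)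

lemma fibDesc_fac {e : E} {Y Z : TermFiber p} {a : A} {u : e ⟶ (incl p).obj Y}
    (hu : p.IsStronglyCocartesian (terminal.from a) u) (f : e ⟶ (incl p).obj Z) :
    u ≫ (incl p).map (fibDesc hu f) = f :=
  have : p.IsHomLift (terminal.from a) f := isHomLift_of_cocartesian hu f
  IsCocartesian.fac (b' := (incl p).obj Z) p (terminal.from a) u f

lemma fibDesc_ext {e : E} {Y Z : TermFiber p} {a : A} {u : e ⟶ (incl p).obj Y}
    (hu : p.IsStronglyCocartesian (terminal.from a) u) {f g : Y ⟶ Z}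
    (w : u ≫ (incl p).map f = u ≫ (incl p).map g) : f = g :=
  have := isHomLift_of_cocartesian hu (u ≫ (incl p).map f)
  Fiber.hom_ext (IsCocartesian.ext p (terminal.from a) u _ _ w)

namespace IsPruned

variable (h : IsPruned p)

/-- The parametrized comonad of a pruned opfibration, associated with the adjunction between
`⟨p, refl⟩` and `(a, Y) ↦ r a × Y`. -/
noncomputable def comonad : A ⥤ Comonad (TermFiber p) := paramComonadOf h.prodAdj.toComonad

@[simp]
lemma comonad_obj (a : A) (Y : TermFiber p) :
    (h.comonad.obj a).obj Y = h.refl.obj (h.prodObj a Y) := rfl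

lemma comonad_map (a : A) {Y Z : TermFiber p} (g : Y ⟶ Z) :
    (h.comonad.obj a).map g = h.refl.map (h.prodMap (𝟙 a) g) := rfl

lemma comonad_map_app {a b : A} (f : a ⟶ b) (Y : TermFiber p) :
    (h.comonad.map f).app Y = h.refl.map (h.prodMap f (𝟙 Y)) := rfl

/-- The counit of the parametrized comonad. -/
noncomputable def ε (a : A) (Y : TermFiber p) : h.refl.obj (h.prodObj a Y) ⟶ Y :=
  (h.comonad.obj a).ε.app Y

/-- The comultiplication of the parametrized comonad. -/
noncomputable def δ (a : A) (Y : TermFiber p) : h.refl.obj (h.prodObj a Y) ⟶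
    h.refl.obj (h.prodObj a (h.refl.obj (h.prodObj a Y))) :=
  (h.comonad.obj a).δ.app Y

lemma ε_eq (a : A) (Y : TermFiber p) :
    h.ε a Y = h.desc (𝟙 _ ≫ h.snd a Y) := rfl

@[simp]
lemma unit_ε (a : A) (Y : TermFiber p) :
    h.unit (h.prodObj a Y) ≫ (incl p).map (h.ε a Y) = h.snd a Y := by
  rw [ε_eq, h.isOpfibration.unit_desc, Category.id_comp]

lemma δ_eq' (a : A) (Y : TermFiber p) :
    h.δ a Y = h.refl.map (h.pair (𝟙 _) (h.unit (h.prodObj a Y) ≫ (incl p).map (𝟙 _))) ≫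
      h.refl.map (h.prodMap (p.map (𝟙 _) ≫ h.proj a Y) (𝟙 _)) := rfl

lemma δ_eq (a : A) (Y : TermFiber p) :
    h.δ a Y = h.refl.map (h.pair (h.proj a Y) (h.unit (h.prodObj a Y))) := by
  rw [δ_eq', ← CategoryTheory.Functor.map_comp]
  congr 1
  apply h.pair_ext
  · simp
  · simp

lemma proj_terminal_ext {e : E} {Y : TermFiber p} {f g : e ⟶ h.prodObj (⊤_ A) Y}
    (w : f ≫ h.snd _ Y = g ≫ h.snd _ Y) : f = g :=
  h.pair_ext (terminal.hom_ext _ _) w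

/-- Over the terminal object, the counit is invertible. -/
noncomputable def εIso (Y : TermFiber p) : h.refl.obj (h.prodObj (⊤_ A) Y) ≅ Y where
  hom := h.ε (⊤_ A) Y
  inv := fibHom (h.pair (terminal.from _) (𝟙 _) ≫ h.unit (h.prodObj (⊤_ A) Y))
  hom_inv_id := h.isOpfibration.unit_ext (by
    have : h.snd (⊤_ A) Y ≫ h.pair (terminal.from _) (𝟙 _) = 𝟙 _ :=
      h.proj_terminal_ext (by simp)
    rw [CategoryTheory.Functor.map_comp, ← Category.assoc, unit_ε, incl_map_fibHom,
      ← Category.assoc, this]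
    simp)
  inv_hom_id := fib_ext (by
    rw [CategoryTheory.Functor.map_comp, incl_map_fibHom, Category.assoc, unit_ε, pair_snd]
    simp)

/-- Over the terminal object, the comonad is the identity up to isomorphism. -/
noncomputable def comonadTerminalIso : (h.comonad.obj (⊤_ A)).toFunctor ≅ 𝟭 (TermFiber p) :=
  NatIso.ofComponents (fun Y => h.εIso Y)
    (fun g => (h.comonad.obj (⊤_ A)).ε.naturality g)

/-- The terminal object of the terminal fibre is the reflection of `r ⊤`. -/
lemma hasTerminal_termFiber (h : IsPruned p) : HasTerminal (TermFiber p) := by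
  let u : h.right.obj (⊤_ A) ⟶ (incl p).obj (h.refl.obj (h.right.obj (⊤_ A))) :=
    h.unit (h.right.obj (⊤_ A))
  have hu : IsIso u := by
    have := h.right_full
    have := h.right_faithful
    have h₁ : IsIso (terminal.from (p.obj (h.right.obj (⊤_ A)))) := by
      have : terminal.from (p.obj (h.right.obj (⊤_ A))) = h.adj.counit.app (⊤_ A) :=
        terminal.hom_ext _ _
      rw [this]
      infer_instance
    exact IsStronglyCocartesian.isIso_of_base_isIso p (terminal.from (p.obj (h.right.obj (⊤_ A)))) u
  have hext (Y : TermFiber p) (f g : (incl p).obj Y ⟶ h.right.obj (⊤_ A)) : f = g :=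
    (h.adj.homEquiv _ _).symm.injective (terminal.hom_ext _ _)
  refine (IsTerminal.ofUniqueHom (Y := h.refl.obj (h.right.obj (⊤_ A)))
    (fun Y => fibHom (h.adj.homEquiv _ _ (terminal.from _) ≫ u)) (fun Y m => fib_ext ?_)).hasTerminal
  rw [← cancel_mono (inv u)]
  exact hext Y _ _

end IsPruned

end

section

variable {A : Type u₁} [Category.{v₁} A] [HasTerminal A]

namespace PrunedOpfib

/-- The pruned comonad of a pruned opfibration. -/
noncomputable abbrev toComonad (P : PrunedOpfib.{v₁, u₁, v, u} A) :
    PrunedComonad.{v₁, u₁, v, u} A where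
  carrier := TermFiber P.p
  comonad := P.isPruned.comonad
  hasTerminal := P.isPruned.hasTerminal_termFiber
  nonempty_iso := ⟨P.isPruned.comonadTerminalIso⟩

section

variable {P Q : PrunedOpfib.{v₁, u₁, v, u} A} (H : Hom P Q)

/-- The functor underlying a morphism of pruned opfibrations. -/
abbrev Hom.functor : P.obj ⥤ Q.obj := H.based.toFunctor

lemma Hom.w_obj (e : P.obj) : Q.p.obj (H.functor.obj e) = P.p.obj e := H.based.w_obj e

lemma Hom.w_map {e e' : P.obj} (f : e ⟶ e') : Q.p.map (H.functor.map f) =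
    eqToHom (H.w_obj e) ≫ P.p.map f ≫ eqToHom (H.w_obj e').symm :=
  Functor.congr_hom H.based.w f

/-- The action on objects of the terminal fibre. -/
noncomputable def Hom.fibObj (Y : TermFiber P.p) : TermFiber Q.p :=
  ⟨H.functor.obj ((incl P.p).obj Y), (H.w_obj _).trans Y.2⟩

/-- The action on arrows of the terminal fibre. -/
noncomputable def Hom.fibMap {Y Z : TermFiber P.p} (g : Y ⟶ Z) : H.fibObj Y ⟶ H.fibObj Z :=
  fibHom (Y := H.fibObj Y) (Z := H.fibObj Z) (H.functor.map ((incl P.p).map g))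

/-- The functor between terminal fibres induced by a morphism of pruned opfibrations. -/
noncomputable def Hom.fib : TermFiber P.p ⥤ TermFiber Q.p where
  obj Y := H.fibObj Y
  map g := H.fibMap g
  map_id Y := Opfib.fib_ext
    ((congrArg H.functor.map ((incl P.p).map_id Y)).trans (H.functor.map_id _))
  map_comp f g := Opfib.fib_ext
    ((congrArg H.functor.map ((incl P.p).map_comp f g)).trans (H.functor.map_comp _ _))

/-- The image under `H` of an arrow into the terminal fibre. -/
noncomputable def Hom.mapIncl {e : P.obj} {Y : TermFiber P.p} (f : e ⟶ (incl P.p).obj Y) :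
    H.functor.obj e ⟶ (incl Q.p).obj (H.fib.obj Y) :=
  H.functor.map f

lemma Hom.map_mapIncl {e e' : P.obj} {Y : TermFiber P.p} (g : e ⟶ e')
    (f : e' ⟶ (incl P.p).obj Y) : H.functor.map g ≫ H.mapIncl f = H.mapIncl (g ≫ f) :=
  (H.functor.map_comp g f).symm

lemma Hom.mapIncl_fib {e : P.obj} {Y Z : TermFiber P.p} (f : e ⟶ (incl P.p).obj Y) (g : Y ⟶ Z) :
    H.mapIncl f ≫ (incl Q.p).map (H.fib.map g) = H.mapIncl (f ≫ (incl P.p).map g) :=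
  (H.functor.map_comp f ((incl P.p).map g)).symm

/-- The image under `H` of the cocartesian arrow from `e` to its reflection. -/
noncomputable abbrev Hom.mapUnit (e : P.obj) :
    H.functor.obj e ⟶ (incl Q.p).obj (H.fib.obj (P.isPruned.refl.obj e)) :=
  H.mapIncl (P.isPruned.unit e)

lemma Hom.mapUnit_cocartesian (e : P.obj) :
    Q.p.IsStronglyCocartesian (terminal.from (P.p.obj e)) (H.mapUnit e) :=
  H.cocartesian _ _ (P.isPruned.isOpfibration.unit_cocartesian e)

lemma Hom.mapUnit_nat {e e' : P.obj} (f : e ⟶ e') :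
    H.mapUnit e ≫ (incl Q.p).map (H.fib.map (P.isPruned.refl.map f)) =
      H.functor.map f ≫ H.mapUnit e' := by
  rw [mapIncl_fib, map_mapIncl, IsOpfibration.unit_nat]

lemma Hom.mapUnit_nat_assoc {e e' : P.obj} (f : e ⟶ e') {z : Q.obj}
    (k : (incl Q.p).obj (H.fib.obj (P.isPruned.refl.obj e')) ⟶ z) :
    H.mapUnit e ≫ (incl Q.p).map (H.fib.map (P.isPruned.refl.map f)) ≫ k =
      H.functor.map f ≫ H.mapUnit e' ≫ k := by
  rw [← Category.assoc, mapUnit_nat, Category.assoc]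

/-- The comparison `H (r a × Y) ⟶ r a × H Y`. -/
noncomputable def Hom.prodComparison (a : A) (Y : TermFiber P.p) :
    H.functor.obj (P.isPruned.prodObj a Y) ⟶ Q.isPruned.prodObj a (H.fib.obj Y) :=
  Q.isPruned.pair (eqToHom (H.w_obj _) ≫ P.isPruned.proj a Y)
    (H.mapIncl (P.isPruned.snd a Y))

@[simp]
lemma Hom.prodComparison_proj (a : A) (Y : TermFiber P.p) :
    Q.p.map (H.prodComparison a Y) ≫ Q.isPruned.proj a (H.fib.obj Y) =
      eqToHom (H.w_obj _) ≫ P.isPruned.proj a Y :=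
  Q.isPruned.pair_proj _ _

@[simp]
lemma Hom.prodComparison_snd (a : A) (Y : TermFiber P.p) :
    H.prodComparison a Y ≫ Q.isPruned.snd a (H.fib.obj Y) =
      H.mapIncl (P.isPruned.snd a Y) :=
  Q.isPruned.pair_snd _ _

lemma Hom.prodComparison_nat {a b : A} (f : a ⟶ b) {Y Z : TermFiber P.p} (g : Y ⟶ Z) :
    H.functor.map (P.isPruned.prodMap f g) ≫ H.prodComparison b Z =
      H.prodComparison a Y ≫ Q.isPruned.prodMap f (H.fib.map g) := by
  apply Q.isPruned.pair_ext
  · rw [CategoryTheory.Functor.map_comp, CategoryTheory.Functor.map_comp, Category.assoc,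
      Category.assoc, prodComparison_proj, IsPruned.prodMap_proj,
      reassoc_of% (H.prodComparison_proj a Y), H.w_map]
    simp
  · rw [Category.assoc, Category.assoc, prodComparison_snd, IsPruned.prodMap_snd,
      reassoc_of% (H.prodComparison_snd a Y), map_mapIncl,
      mapIncl_fib, IsPruned.prodMap_snd]

/-- The 2-cell `H (S_a Y) ⟶ T_a (H Y)`: it is the unique arrow of the terminal fibre whose
composite with the image of `r a × Y ⟶ S_a Y` is the composite of `H (r a × Y) ⟶ r a × H Y` and
`r a × H Y ⟶ T_a (H Y)`. -/
noncomputable def Hom.dist (a : A) (Y : TermFiber P.p) :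
    H.fib.obj (P.isPruned.refl.obj (P.isPruned.prodObj a Y)) ⟶
      Q.isPruned.refl.obj (Q.isPruned.prodObj a (H.fib.obj Y)) :=
  fibDesc (H.mapUnit_cocartesian (P.isPruned.prodObj a Y))
    (H.prodComparison a Y ≫ Q.isPruned.unit _)

lemma Hom.mapUnit_dist (a : A) (Y : TermFiber P.p) :
    H.mapUnit (P.isPruned.prodObj a Y) ≫ (incl Q.p).map (H.dist a Y) =
      H.prodComparison a Y ≫ Q.isPruned.unit _ :=
  fibDesc_fac _ _

lemma Hom.mapUnit_dist_assoc (a : A) (Y : TermFiber P.p) {z : Q.obj}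
    (k : (incl Q.p).obj (Q.isPruned.refl.obj (Q.isPruned.prodObj a (H.fib.obj Y))) ⟶ z) :
    H.mapUnit (P.isPruned.prodObj a Y) ≫ (incl Q.p).map (H.dist a Y) ≫ k =
      H.prodComparison a Y ≫ Q.isPruned.unit _ ≫ k := by
  rw [← Category.assoc, mapUnit_dist, Category.assoc]

lemma Hom.fib_ext {e : P.obj} {Z : TermFiber Q.p}
    {f g : H.fib.obj (P.isPruned.refl.obj e) ⟶ Z}
    (w : H.mapUnit e ≫ (incl Q.p).map f = H.mapUnit e ≫ (incl Q.p).map g) : f = g :=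
  fibDesc_ext (H.mapUnit_cocartesian e) w

lemma Hom.dist_nat {a b : A} (f : a ⟶ b) {Y Z : TermFiber P.p} (g : Y ⟶ Z) :
    H.fib.map (P.isPruned.refl.map (P.isPruned.prodMap f g)) ≫ H.dist b Z =
      H.dist a Y ≫ Q.isPruned.refl.map (Q.isPruned.prodMap f (H.fib.map g)) := by
  apply H.fib_ext
  rw [CategoryTheory.Functor.map_comp, CategoryTheory.Functor.map_comp, mapUnit_nat_assoc,
    mapUnit_dist, mapUnit_dist_assoc, IsOpfibration.unit_nat,
    reassoc_of% (H.prodComparison_nat f g)]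

lemma Hom.dist_ε (a : A) (Y : TermFiber P.p) :
    H.dist a Y ≫ Q.isPruned.ε a (H.fib.obj Y) = H.fib.map (P.isPruned.ε a Y) := by
  apply H.fib_ext
  rw [CategoryTheory.Functor.map_comp, mapUnit_dist_assoc, IsPruned.unit_ε,
    prodComparison_snd, mapIncl_fib, IsPruned.unit_ε]

lemma Hom.prodComparison_comult (a : A) (Y : TermFiber P.p) :
    H.prodComparison a Y ≫ Q.isPruned.pair (Q.isPruned.proj a (H.fib.obj Y))
        (Q.isPruned.unit (Q.isPruned.prodObj a (H.fib.obj Y))) =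
      H.functor.map (P.isPruned.pair (P.isPruned.proj a Y)
          (P.isPruned.unit (P.isPruned.prodObj a Y))) ≫
        H.prodComparison a _ ≫ Q.isPruned.prodMap (𝟙 a) (H.dist a Y) := by
  apply Q.isPruned.pair_ext
  · rw [CategoryTheory.Functor.map_comp, CategoryTheory.Functor.map_comp,
      CategoryTheory.Functor.map_comp, Category.assoc, IsPruned.pair_proj, prodComparison_proj,
      Category.assoc, Category.assoc, IsPruned.prodMap_proj, Category.comp_id,
      prodComparison_proj, H.w_map]
    simp
  · rw [Category.assoc, IsPruned.pair_snd, Category.assoc, Category.assoc, IsPruned.prodMap_snd,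
      reassoc_of% (H.prodComparison_snd a (P.isPruned.refl.obj (P.isPruned.prodObj a Y))),
      ← Category.assoc, map_mapIncl, IsPruned.pair_snd, mapUnit_dist]

lemma Hom.dist_δ (a : A) (Y : TermFiber P.p) :
    H.dist a Y ≫ Q.isPruned.δ a (H.fib.obj Y) = H.fib.map (P.isPruned.δ a Y) ≫
      H.dist a (P.isPruned.refl.obj (P.isPruned.prodObj a Y)) ≫
        Q.isPruned.refl.map (Q.isPruned.prodMap (𝟙 a) (H.dist a Y)) := by
  apply H.fib_ext
  rw [IsPruned.δ_eq, IsPruned.δ_eq, CategoryTheory.Functor.map_comp,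
    CategoryTheory.Functor.map_comp, CategoryTheory.Functor.map_comp, mapUnit_dist_assoc,
    mapUnit_nat_assoc, mapUnit_dist_assoc, IsOpfibration.unit_nat, IsOpfibration.unit_nat,
    reassoc_of% (H.prodComparison_comult a Y)]

/-- The morphism of pruned comonads induced by a morphism of pruned opfibrations. -/
noncomputable abbrev mapComonad : ParamComonad.Hom P.toComonad.toParamComonad
    Q.toComonad.toParamComonad where
  functor := H.fib
  dist a Y := H.dist a Y
  naturality a _ _ g := H.dist_nat (𝟙 a) g
  naturality_base f Y := by
    refine (H.dist_nat f (𝟙 Y)).trans ?_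
    rw [CategoryTheory.Functor.map_id]
    rfl
  counit a Y := H.dist_ε a Y
  comult a Y := H.dist_δ a Y

variable {H} {K : Hom P Q} (α : H ⟶ K)

/-- The action of a 2-cell on the terminal fibres. -/
noncomputable def fibNatTrans : H.fib ⟶ K.fib where
  app Y := fibHom (NatTrans.app (BasedNatTrans.toNatTrans α) ((incl P.p).obj Y))
  naturality Y Z g := Opfib.fib_ext
    ((BasedNatTrans.toNatTrans α).naturality ((incl P.p).map g))

/-- The component of a 2-cell. -/
def comp₂ (e : P.obj) : H.functor.obj e ⟶ K.functor.obj e :=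
  NatTrans.app (BasedNatTrans.toNatTrans α) e

lemma mapIncl_comp₂ {e : P.obj} {Y : TermFiber P.p} (f : e ⟶ (incl P.p).obj Y) :
    H.mapIncl f ≫ (incl Q.p).map ((fibNatTrans α).app Y) = comp₂ α e ≫ K.mapIncl f :=
  (BasedNatTrans.toNatTrans α).naturality f

lemma comp₂_base (e : P.obj) :
    Q.p.map (comp₂ α e) = eqToHom ((H.w_obj e).trans (K.w_obj e).symm) := by
  have : Q.p.IsHomLift (𝟙 (P.p.obj e)) (comp₂ α e) := BasedNatTrans.isHomLift' α e
  rw [IsHomLift.fac' Q.p (𝟙 (P.p.obj e)) (comp₂ α e)]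
  simp

lemma prodComparison_comp₂ (a : A) (Y : TermFiber P.p) :
    H.prodComparison a Y ≫ Q.isPruned.prodMap (𝟙 a) ((fibNatTrans α).app Y) =
      comp₂ α (P.isPruned.prodObj a Y) ≫ K.prodComparison a Y := by
  apply Q.isPruned.pair_ext
  · rw [CategoryTheory.Functor.map_comp, CategoryTheory.Functor.map_comp, Category.assoc,
      IsPruned.prodMap_proj, Category.comp_id, Hom.prodComparison_proj, Category.assoc,
      Hom.prodComparison_proj, comp₂_base]
    simp
  · rw [Category.assoc, IsPruned.prodMap_snd, reassoc_of% (H.prodComparison_snd a Y),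
      mapIncl_comp₂, Category.assoc, Hom.prodComparison_snd]

/-- The 2-cell of pruned comonads induced by a 2-cell of pruned opfibrations. -/
noncomputable abbrev map₂Comonad : ParamComonad.Hom₂ (mapComonad H) (mapComonad K) where
  trans := fibNatTrans α
  comm a Y := by
    change H.dist a Y ≫ Q.isPruned.refl.map
        (Q.isPruned.prodMap (𝟙 a) ((fibNatTrans α).app Y)) =
      (fibNatTrans α).app (P.isPruned.refl.obj (P.isPruned.prodObj a Y)) ≫ K.dist a Y
    apply H.fib_ext
    rw [CategoryTheory.Functor.map_comp, CategoryTheory.Functor.map_comp,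
      Hom.mapUnit_dist_assoc, IsOpfibration.unit_nat,
      reassoc_of% (mapIncl_comp₂ α (P.isPruned.unit (P.isPruned.prodObj a Y))),
      Hom.mapUnit_dist, reassoc_of% (prodComparison_comp₂ α a Y)]

end

lemma id_prodComparison (P : PrunedOpfib.{v₁, u₁, v, u} A) (a : A) (Y : TermFiber P.p) :
    (Hom.id P).prodComparison a Y = 𝟙 (P.isPruned.prodObj a Y) := by
  have h : P.isPruned.pair (Y := Y) (eqToHom rfl ≫ P.isPruned.proj a Y) (P.isPruned.snd a Y) =
      𝟙 (P.isPruned.prodObj a Y) := by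
    apply P.isPruned.pair_ext <;> simp
  exact h

lemma id_dist (P : PrunedOpfib.{v₁, u₁, v, u} A) (a : A) (Y : TermFiber P.p) :
    (Hom.id P).dist a Y = 𝟙 (P.isPruned.refl.obj (P.isPruned.prodObj a Y)) := by
  refine (Hom.id P).fib_ext (((Hom.id P).mapUnit_dist a Y).trans ?_)
  refine (congrArg (· ≫ P.isPruned.unit (P.isPruned.prodObj a Y))
    (id_prodComparison P a Y)).trans ?_
  refine (Category.id_comp (P.isPruned.unit (P.isPruned.prodObj a Y))).trans ?_
  exact ((congrArg (P.isPruned.unit (P.isPruned.prodObj a Y) ≫ ·)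
    ((incl P.p).map_id _)).trans (Category.comp_id _)).symm

section

variable {P Q R : PrunedOpfib.{v₁, u₁, v, u} A} (H : Hom P Q) (K : Hom Q R)

lemma comp_prodComparison (a : A) (Y : TermFiber P.p) :
    (H.comp K).prodComparison a Y =
      K.functor.map (H.prodComparison a Y) ≫ K.prodComparison a (H.fib.obj Y) := by
  have e : R.p.obj (K.functor.obj (H.functor.obj (P.isPruned.prodObj a Y))) =
      P.p.obj (P.isPruned.prodObj a Y) := (H.comp K).w_obj (P.isPruned.prodObj a Y)
  have h : R.isPruned.pair (e := K.functor.obj (H.functor.obj (P.isPruned.prodObj a Y)))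
      (Y := K.fib.obj (H.fib.obj Y)) (eqToHom e ≫ P.isPruned.proj a Y)
      (K.mapIncl (H.mapIncl (P.isPruned.snd a Y))) =
        K.functor.map (H.prodComparison a Y) ≫ K.prodComparison a (H.fib.obj Y) := by
    apply R.isPruned.pair_ext
    · rw [IsPruned.pair_proj, CategoryTheory.Functor.map_comp, Category.assoc,
        Hom.prodComparison_proj, K.w_map]
      simp
    · rw [IsPruned.pair_snd, Category.assoc, Hom.prodComparison_snd, Hom.map_mapIncl,
        Hom.prodComparison_snd]
  exact h

lemma comp_dist (a : A) (Y : TermFiber P.p) :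
    (H.comp K).dist a Y = K.fib.map (H.dist a Y) ≫ K.dist a (H.fib.obj Y) := by
  refine (H.comp K).fib_ext (((H.comp K).mapUnit_dist a Y).trans ?_)
  refine (congrArg (· ≫ R.isPruned.unit (R.isPruned.prodObj a (K.fib.obj (H.fib.obj Y))))
    (comp_prodComparison H K a Y)).trans ?_
  change (K.functor.map (H.prodComparison a Y) ≫ K.prodComparison a (H.fib.obj Y)) ≫
    R.isPruned.unit (R.isPruned.prodObj a (K.fib.obj (H.fib.obj Y))) = K.mapIncl (H.mapUnit (P.isPruned.prodObj a Y)) ≫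
    (incl R.p).map (K.fib.map (H.dist a Y) ≫ K.dist a (H.fib.obj Y))
  rw [CategoryTheory.Functor.map_comp, ← Category.assoc, Hom.mapIncl_fib, Hom.mapUnit_dist,
    ← Hom.map_mapIncl, Category.assoc, Category.assoc, Hom.mapUnit_dist]

/-- The action on identities. -/
noncomputable def mapComonadId (P : PrunedOpfib.{v₁, u₁, v, u} A) :
    mapComonad (Hom.id P) ≅ ParamComonad.Hom.id P.toComonad.toParamComonad :=
  ParamComonad.isoMk
    (NatIso.ofComponents (F := (Hom.id P).fib) (G := CategoryTheory.Functor.id (TermFiber P.p))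
      (fun Y => (Iso.refl Y : Y ≅ Y))
      (fun {Y Z} g => (Category.comp_id g).trans (Category.id_comp g).symm))
    (fun a Y => by
      change (Hom.id P).dist a Y ≫ P.isPruned.refl.map (P.isPruned.prodMap (𝟙 a) (𝟙 Y)) =
        𝟙 (P.isPruned.refl.obj (P.isPruned.prodObj a Y)) ≫
          𝟙 (P.isPruned.refl.obj (P.isPruned.prodObj a Y))
      have h : P.isPruned.refl.map (P.isPruned.prodMap (𝟙 a) (𝟙 Y)) = 𝟙 _ :=
        (P.isPruned.comonad.obj a).map_id Y
      exact congrArg₂ (fun f g => f ≫ g) (id_dist P a Y) h)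

/-- The action on compositions. -/
noncomputable def mapComonadComp :
    mapComonad (H.comp K) ≅ ParamComonad.Hom.comp (mapComonad H) (mapComonad K) :=
  ParamComonad.isoMk
    (NatIso.ofComponents (F := (H.comp K).fib) (G := CategoryTheory.Functor.comp H.fib K.fib)
      (fun Y => (Iso.refl (K.fib.obj (H.fib.obj Y)) :
        K.fib.obj (H.fib.obj Y) ≅ K.fib.obj (H.fib.obj Y)))
      (fun {Y Z} g => (Category.comp_id (K.fib.map (H.fib.map g))).trans
        (Category.id_comp (K.fib.map (H.fib.map g))).symm))
    (fun a Y => by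
      change (H.comp K).dist a Y ≫ R.isPruned.refl.map (R.isPruned.prodMap (𝟙 a)
          (𝟙 (K.fib.obj (H.fib.obj Y)))) =
        𝟙 (K.fib.obj (H.fib.obj (P.isPruned.refl.obj (P.isPruned.prodObj a Y)))) ≫
          K.fib.map (H.dist a Y) ≫ K.dist a (H.fib.obj Y)
      have h : R.isPruned.refl.map (R.isPruned.prodMap (𝟙 a) (𝟙 (K.fib.obj (H.fib.obj Y)))) =
          𝟙 _ := (R.isPruned.comonad.obj a).map_id _
      rw [Category.id_comp]
      exact (congrArg₂ (fun f g => f ≫ g) (comp_dist H K a Y) h).trans (Category.comp_id _))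

end

/-- The pseudofunctor sending a pruned opfibration to its pruned comonad. -/
noncomputable def assocComonad (A : Type u₁) [Category.{v₁} A] [HasTerminal A] :
    Pseudofunctor (PrunedOpfib.{v₁, u₁, v, u} A) (PrunedComonad.{v₁, u₁, v, u} A) where
  obj P := P.toComonad
  map H := mapComonad H
  map₂ α := map₂Comonad α
  map₂_id F := ParamComonad.hom₂_ext fun Y => rfl
  map₂_comp α β := ParamComonad.hom₂_ext fun Y => rfl
  mapId P := mapComonadId P
  mapComp F G := mapComonadComp F G
  map₂_whisker_left {P Q R} F {G H} α := ParamComonad.hom₂_ext fun Y => by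
    change (fibNatTrans α).app (F.fib.obj Y) =
      𝟙 (G.fib.obj (F.fib.obj Y)) ≫ (fibNatTrans α).app (F.fib.obj Y) ≫
        𝟙 (H.fib.obj (F.fib.obj Y))
    simp
  map₂_whisker_right {P Q R F G} α H := ParamComonad.hom₂_ext fun Y => by
    change H.fib.map ((fibNatTrans α).app Y) =
      𝟙 (H.fib.obj (F.fib.obj Y)) ≫ H.fib.map ((fibNatTrans α).app Y) ≫
        𝟙 (H.fib.obj (G.fib.obj Y))
    simp
  map₂_associator {P Q R T} F G H := ParamComonad.hom₂_ext fun Y => by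
    change 𝟙 (H.fib.obj (G.fib.obj (F.fib.obj Y))) =
      𝟙 _ ≫ H.fib.map (𝟙 (G.fib.obj (F.fib.obj Y))) ≫ 𝟙 _ ≫ 𝟙 _ ≫ 𝟙 _
    simp
  map₂_left_unitor {P Q} F := ParamComonad.hom₂_ext fun Y => by
    change 𝟙 (F.fib.obj Y) = 𝟙 _ ≫ F.fib.map (𝟙 Y) ≫ 𝟙 _
    simp
  map₂_right_unitor {P Q} F := ParamComonad.hom₂_ext fun Y => by
    change 𝟙 (F.fib.obj Y) = 𝟙 _ ≫ 𝟙 _ ≫ 𝟙 _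
    simp

end PrunedOpfib

end

/-! ### The comparison with the coEilenberg-Moore opfibration -/

namespace PrunedOpfib

open ParamComonad

variable {A : Type u₁} [Category.{v₁} A] [HasTerminal A]

section

variable (P : PrunedOpfib.{v₁, u₁, v, u} A)

/-- The arrow `e ⟶ r (p e) × refl e` whose components are the units of the two adjunctions. -/
noncomputable def graph (e : P.obj) :
    e ⟶ P.isPruned.prodObj (P.p.obj e) (P.isPruned.refl.obj e) :=
  P.isPruned.pair (𝟙 (P.p.obj e)) (P.isPruned.unit e)

@[simp]
lemma graph_proj (e : P.obj) : P.p.map (P.graph e) ≫ P.isPruned.proj _ _ = 𝟙 _ :=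
  P.isPruned.pair_proj _ _

@[simp]
lemma graph_snd (e : P.obj) : P.graph e ≫ P.isPruned.snd _ _ = P.isPruned.unit e :=
  P.isPruned.pair_snd _ _

lemma graph_counit (e : P.obj) :
    P.isPruned.refl.map (P.graph e) ≫ P.isPruned.ε _ _ = 𝟙 (P.isPruned.refl.obj e) := by
  apply P.isPruned.isOpfibration.unit_ext
  rw [CategoryTheory.Functor.map_comp, IsOpfibration.unit_nat_assoc, IsPruned.unit_ε, graph_snd,
    CategoryTheory.Functor.map_id, Category.comp_id]

lemma graph_coassoc (e : P.obj) :
    P.isPruned.refl.map (P.graph e) ≫ P.isPruned.δ _ _ =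
      P.isPruned.refl.map (P.graph e) ≫
        P.isPruned.refl.map (P.isPruned.prodMap (𝟙 _) (P.isPruned.refl.map (P.graph e))) := by
  rw [IsPruned.δ_eq, ← CategoryTheory.Functor.map_comp, ← CategoryTheory.Functor.map_comp]
  congr 1
  apply P.isPruned.pair_ext
  · simp
  · rw [Category.assoc, Category.assoc, IsPruned.pair_snd, IsPruned.prodMap_snd,
      reassoc_of% (P.graph_snd e), IsOpfibration.unit_nat]

lemma graph_nat {e e' : P.obj} (f : e ⟶ e') :
    (P.isPruned.refl.map (P.graph e) ≫
      P.isPruned.refl.map (P.isPruned.prodMap (P.p.map f) (𝟙 _))) ≫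
        P.isPruned.refl.map (P.isPruned.prodMap (𝟙 _) (P.isPruned.refl.map f)) =
      P.isPruned.refl.map f ≫ P.isPruned.refl.map (P.graph e') := by
  rw [← CategoryTheory.Functor.map_comp, ← CategoryTheory.Functor.map_comp,
    ← CategoryTheory.Functor.map_comp]
  congr 1
  apply P.isPruned.pair_ext
  · simp [reassoc_of% (P.graph_proj e)]
  · rw [Category.assoc, Category.assoc, Category.assoc, graph_snd, IsPruned.prodMap_snd,
      IsPruned.prodMap_snd_assoc, reassoc_of% (P.graph_snd e), CategoryTheory.Functor.map_id,
      Category.id_comp, IsOpfibration.unit_nat]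

/-- The coalgebra associated with an object of the total category: its carrier is the reflection
of `e` in the terminal fibre. -/
noncomputable abbrev compareObj (e : P.obj) : Total P.toComonad.toParamComonad where
  base := P.p.obj e
  coalg :=
    { A := P.isPruned.refl.obj e
      a := P.isPruned.refl.map (P.graph e)
      counit := P.graph_counit e
      coassoc := P.graph_coassoc e }

/-- The comparison functor, from the total category to the category of coalgebras. -/
noncomputable def compare : P.obj ⥤ Total P.toComonad.toParamComonad where
  obj e := P.compareObj e
  map f :=
    { base := P.p.map f
      carrier := P.isPruned.refl.map f
      comm := P.graph_nat f }
  map_id e := Total.hom_ext (P.p.map_id e) (P.isPruned.refl.map_id e)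
  map_comp f g := Total.hom_ext (P.p.map_comp f g) (P.isPruned.refl.map_comp f g)

/-- The reflector inverts cocartesian arrows. -/
lemma isIso_refl_map {e e' : P.obj} (φ : e ⟶ e') {a b : A} (f : a ⟶ b)
    (h : P.p.IsStronglyCocartesian f φ) : IsIso (P.isPruned.refl.map φ) := by
  obtain rfl : a = P.p.obj e := (IsHomLift.domain_eq P.p f φ).symm
  obtain rfl : b = P.p.obj e' := (IsHomLift.codomain_eq P.p f φ).symm
  have hu : P.p.IsStronglyCocartesian (terminal.from (P.p.obj e)) (φ ≫ P.isPruned.unit e') := by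
    have : terminal.from (P.p.obj e) = f ≫ terminal.from (P.p.obj e') := terminal.hom_ext _ _
    rw [this]
    infer_instance
  refine ⟨fibDesc hu (P.isPruned.unit e), P.isPruned.isOpfibration.unit_ext ?_,
    fibDesc_ext hu ?_⟩
  · rw [CategoryTheory.Functor.map_comp, IsOpfibration.unit_nat_assoc, ← Category.assoc,
      fibDesc_fac, CategoryTheory.Functor.map_id, Category.comp_id]
  · rw [CategoryTheory.Functor.map_comp, ← Category.assoc, fibDesc_fac, IsOpfibration.unit_nat,
      CategoryTheory.Functor.map_id, Category.comp_id]

lemma compare_cocartesian {e e' : P.obj} {a b : A} (f : a ⟶ b) (φ : e ⟶ e')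
    (h : P.p.IsStronglyCocartesian f φ) :
    (ParamComonad.proj _).IsStronglyCocartesian f (P.compare.map φ) := by
  have hf : (ParamComonad.proj _).IsHomLift f (P.compare.map φ) := by
    obtain rfl : a = P.p.obj e := (IsHomLift.domain_eq P.p f φ).symm
    obtain rfl : b = P.p.obj e' := (IsHomLift.codomain_eq P.p f φ).symm
    obtain rfl : f = P.p.map φ := IsHomLift.eq_of_isHomLift P.p f φ
    exact isHomLift_base (P.compare.map φ)
  have : IsIso (P.compare.map φ).carrier := P.isIso_refl_map φ f h
  exact cocartesian_of_isIso _ _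

end

/-- The comparison morphism, from a pruned opfibration `p` to the coEilenberg-Moore opfibration
of its comonad. -/
noncomputable def comparison (P : PrunedOpfib.{v₁, u₁, max v₁ v, max u₁ u v₁ v} A) :
    P ⟶ (PrunedComonad.coEM A).obj ((assocComonad A).obj P) :=
  ({ based := { toFunctor := P.compare, w := rfl }
     cocartesian := P.compare_cocartesian } : Hom P P.toComonad.toOpfib)

end PrunedOpfib

/-- A strong transformation `η : 𝟭 ⟶ L ⋙ R` exhibits `L` as left biadjoint to `R` if, for all `b`
and `c`, the functor `(L b ⟶ c) ⥤ (b ⟶ R c)`, `g ↦ η b ≫ R g`, is an equivalence of categories. -/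
def IsBiadjunctionUnit {B : Type u₁} [Bicategory.{w₁, v₁} B] {C : Type u} [Bicategory.{w, v} C]
    (L : Pseudofunctor B C) (R : Pseudofunctor C B)
    (η : Pseudofunctor.StrongTrans (Pseudofunctor.id B) (L.comp R)) : Prop :=
  ∀ (b : B) (c : C), (CategoryTheory.Functor.comp (R.mapFunctor (L.obj b) c)
    (Bicategory.precomp (R.obj c) (η.app b))).IsEquivalence

end Opfib

/-! Write `L` for `assocComonad` and `R` for `coEM`. Three facts carry the theorem.

A morphism `H` of pruned opfibrations preserves cocartesian arrows, so `H` of the arrow from `e` to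
its reflection and the arrow from `H e` to its reflection are two cocartesian lifts of the same
arrow to the terminal object. This gives the isomorphism `Hom.reflIso`. All coalgebra structures
involved come from arrows into products `r a × Y`, so its compatibility with them is checked on two
components; it is the constraint that makes the comparison pseudonatural.

A coalgebra over the terminal object is just its carrier, since `S_⊤` is the identity up to its
counit; hence the terminal fibre of `p^S` is equivalent to the category of carriers `X`
(`fiberForget`), which settles the statement on initial objects. Moreover the cofree coalgebra over
`a` on the carrier of `Y` is a product `r a × Y`, so the comonad of `p^S` is carried to `S` by an
invertible family (`counitDist`). This is the counit `L R S ⟶ S`, and it satisfies a triangle with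
the comparison (`triangleIso`).

Every object of the terminal fibre is its own reflection, so a 2-cell between morphisms `L P ⟶ S` is
the same as a natural family indexed by the reflections of the objects of the total category.
Compatibility with the structure arrows at `(a, Y)` reduces to the coalgebra condition at the single
object `e = r a × Y`: the structure map of the comparison coalgebra of `e` is a section of the arrow
`S_(p e) (S_a Y) ⟶ S_a Y` (`graph_section`), and the structure arrow at `(a, Y)` is a retract of the
one at `(p e, S_a Y)` (`Hom.dist_eq_of_section`). So transposition is fully faithful by direct
argument, and essentially surjective by naturality of the comparison and the one triangle.

For the characterisation of the image, the functor on coalgebras induced by the counit is fully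
faithful and, by the triangle, essentially surjective, so the comparison of every `p^S` is an
equivalence of categories. This passes along equivalences by naturality. Conversely, an equivalence
of categories over `A` has an inverse in the 2-category: preimages can be moved into the right fibre
by pushing forward along isomorphisms, and a fully faithful functor over `A` reflects cocartesian
arrows.

The universe levels used for the biadjunction absorb those of `A`, because the objects and arrows of
`p^S` contain objects and arrows of `A`; with this choice both constructions stay at the same
levels. -/

namespace Opfib

open ParamComonad

/-! ### Morphisms of pruned opfibrations and reflections onto the terminal fibre -/

namespace PrunedOpfib

variable {A : Type u₁} [Category.{v₁} A] [HasTerminal A]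

section

variable {P Q : PrunedOpfib.{v₁, u₁, v, u} A} (H : Hom P Q)

/-- A morphism of pruned opfibrations commutes with the reflections onto the terminal fibres. -/
noncomputable def Hom.reflIso (e : P.obj) :
    Q.isPruned.refl.obj (H.functor.obj e) ≅ H.fib.obj (P.isPruned.refl.obj e) where
  hom := Q.isPruned.desc (H.mapUnit e)
  inv := fibDesc (H.mapUnit_cocartesian e) (Q.isPruned.unit (H.functor.obj e))
  hom_inv_id := Q.isPruned.isOpfibration.unit_ext (by
    rw [CategoryTheory.Functor.map_comp, ← Category.assoc, IsOpfibration.unit_desc, fibDesc_fac,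
      CategoryTheory.Functor.map_id, Category.comp_id])
  inv_hom_id := H.fib_ext (by
    rw [CategoryTheory.Functor.map_comp, ← Category.assoc, fibDesc_fac, IsOpfibration.unit_desc,
      CategoryTheory.Functor.map_id, Category.comp_id])

@[simp]
lemma Hom.unit_reflIso (e : P.obj) :
    Q.isPruned.unit (H.functor.obj e) ≫ (incl Q.p).map (H.reflIso e).hom = H.mapUnit e :=
  Q.isPruned.isOpfibration.unit_desc _

@[simp]
lemma Hom.unit_reflIso_assoc (e : P.obj) {z : Q.obj}
    (k : (incl Q.p).obj (H.fib.obj (P.isPruned.refl.obj e)) ⟶ z) :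
    Q.isPruned.unit (H.functor.obj e) ≫ (incl Q.p).map (H.reflIso e).hom ≫ k =
      H.mapUnit e ≫ k := by
  rw [← Category.assoc, unit_reflIso]

/-- An arrow into a product `r a × Y` is determined by its two components. Here the first ones are
identities up to the equality `Q.p (H e) = P.p e`, which accounts for the `eqToHom`, and the second
ones are both `H.mapUnit e`. -/
lemma Hom.graph_prodComparison (e : P.obj) :
    Q.graph (H.functor.obj e) ≫ Q.isPruned.prodMap (eqToHom (H.w_obj e)) (H.reflIso e).hom =
      H.functor.map (P.graph e) ≫ H.prodComparison (P.p.obj e) (P.isPruned.refl.obj e) := by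
  apply Q.isPruned.pair_ext
  · rw [CategoryTheory.Functor.map_comp, CategoryTheory.Functor.map_comp, Category.assoc,
      Category.assoc, IsPruned.prodMap_proj, reassoc_of% (Q.graph_proj (H.functor.obj e)),
      prodComparison_proj, H.w_map]
    simp
  · rw [Category.assoc, Category.assoc, IsPruned.prodMap_snd, prodComparison_snd, map_mapIncl,
      graph_snd, reassoc_of% (Q.graph_snd (H.functor.obj e)), unit_reflIso]

/-- This makes `H.reflIso e` an arrow of coalgebras, from the comparison coalgebra of `H e` to the
image of that of `e`. After composition with the unit of the reflection it becomes
`graph_prodComparison`, once the arrow of products is split into its base part and its carrier part.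
-/
lemma Hom.reflIso_coalg (e : P.obj) :
    (Q.isPruned.refl.map (Q.graph (H.functor.obj e)) ≫
        Q.isPruned.refl.map (Q.isPruned.prodMap (eqToHom (H.w_obj e)) (𝟙 _))) ≫
          Q.isPruned.refl.map (Q.isPruned.prodMap (𝟙 _) (H.reflIso e).hom) =
      (H.reflIso e).hom ≫ H.fib.map (P.isPruned.refl.map (P.graph e)) ≫
        H.dist (P.p.obj e) (P.isPruned.refl.obj e) := by
  have h : Q.isPruned.prodMap (eqToHom (H.w_obj e)) (𝟙 _) ≫
      Q.isPruned.prodMap (𝟙 _) (H.reflIso e).hom =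
        Q.isPruned.prodMap (eqToHom (H.w_obj e)) (H.reflIso e).hom := by
    apply Q.isPruned.pair_ext <;> simp
  apply Q.isPruned.isOpfibration.unit_ext
  rw [Category.assoc, ← CategoryTheory.Functor.map_comp, ← CategoryTheory.Functor.map_comp, h,
    graph_prodComparison, IsOpfibration.unit_nat, CategoryTheory.Functor.map_comp,
    CategoryTheory.Functor.map_comp, unit_reflIso_assoc, mapUnit_nat_assoc, mapUnit_dist,
    Category.assoc]

/-- The component of the naturality constraint of the comparison functors. -/
noncomputable def Hom.compareHom (e : P.obj) :
    Q.compare.obj (H.functor.obj e) ⟶ (mapComonad H).mapTotal.obj (P.compare.obj e) where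
  base := eqToHom (H.w_obj e)
  carrier := (H.reflIso e).hom
  comm := H.reflIso_coalg e

lemma Hom.reflIso_nat {e e' : P.obj} (f : e ⟶ e') :
    Q.isPruned.refl.map (H.functor.map f) ≫ (H.reflIso e').hom =
      (H.reflIso e).hom ≫ H.fib.map (P.isPruned.refl.map f) := by
  apply Q.isPruned.isOpfibration.unit_ext
  rw [CategoryTheory.Functor.map_comp, IsOpfibration.unit_nat_assoc, unit_reflIso,
    CategoryTheory.Functor.map_comp, unit_reflIso_assoc, mapUnit_nat]

end

end PrunedOpfib

/-! ### Invertible and vertical arrows of coalgebras -/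

namespace ParamComonad

variable {A : Type u₁} [Category.{v₁} A] {S : ParamComonad.{v₁, u₁, v, u} A}

/-- An arrow of coalgebras is invertible if its two components are. -/
lemma Total.isIso_of_isIso {M N : Total S} (φ : M ⟶ N) [IsIso φ.base] [IsIso φ.carrier] :
    IsIso φ := by
  -- Invertibility on carriers makes `φ` cocartesian, and a cocartesian arrow over an isomorphism is
  -- an isomorphism.
  have : (proj S).IsHomLift φ.base φ := isHomLift_base φ
  have : (proj S).IsStronglyCocartesian φ.base φ := cocartesian_of_isIso φ φ.base
  exact IsStronglyCocartesian.isIso_of_base_isIso (proj S) φ.base φ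

/-- Recognises vertical arrows whose ends lie over `a` only up to a propositional equality. The
constraint `Hom.compareHom` is of this kind. -/
lemma isHomLift_id_of_base {M N : Total S} (φ : M ⟶ N) {a : A} (h₁ : M.base = a)
    (h₂ : N.base = a) (h : φ.base = eqToHom (h₁.trans h₂.symm)) :
    (proj S).IsHomLift (𝟙 a) φ := by
  subst h₁
  refine IsHomLift.of_fac _ _ _ rfl h₂ ?_
  change 𝟙 _ = 𝟙 _ ≫ φ.base ≫ eqToHom h₂
  rw [h]
  simp

end ParamComonad

/-! ### Pseudonaturality of the comparison -/

namespace PrunedOpfib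

variable {A : Type u₁} [Category.{v₁} A] [HasTerminal A]

section

variable {P Q : PrunedOpfib.{v₁, u₁, v, u} A} (H : Hom P Q)

instance (e : P.obj) : IsIso (H.compareHom e) :=
  have : IsIso (Total.Hom.base (H.compareHom e)) := inferInstanceAs (IsIso (eqToHom (H.w_obj e)))
  have : IsIso (Total.Hom.carrier (H.compareHom e)) := inferInstanceAs (IsIso (H.reflIso e).hom)
  Total.isIso_of_isIso _

/-- The comparison functors are natural in morphisms of pruned opfibrations. -/
noncomputable def compareNatIso :
    CategoryTheory.Functor.comp H.functor Q.compare ≅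
      CategoryTheory.Functor.comp P.compare (mapComonad H).mapTotal :=
  NatIso.ofComponents (F := CategoryTheory.Functor.comp H.functor Q.compare)
    (G := CategoryTheory.Functor.comp P.compare (mapComonad H).mapTotal)
    (fun e => asIso (H.compareHom e))
    (fun {e e'} f => Total.hom_ext
      (by
        change Q.p.map (H.functor.map f) ≫ eqToHom (H.w_obj e') =
          eqToHom (H.w_obj e) ≫ P.p.map f
        rw [H.w_map]
        simp)
      (H.reflIso_nat f))

end

section

variable {P Q : PrunedOpfib.{v₁, u₁, max v₁ v, max u₁ u v₁ v} A}

/-- The naturality constraint of the comparison. -/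
noncomputable def comparisonNaturality (H : P ⟶ Q) :
    H ≫ comparison.{v₁, u₁, v, u} Q ≅ comparison.{v₁, u₁, v, u} P ≫
      (PrunedComonad.coEM A).map ((assocComonad A).map H) :=
  PrunedOpfib.isoMk (BasedNatIso.mkNatIso (compareNatIso H)
    (fun e => isHomLift_id_of_base (S := Q.toComonad.toParamComonad)
      (Hom.compareHom H e) (Hom.w_obj H e) rfl rfl))

end

section

variable {P Q R : PrunedOpfib.{v₁, u₁, v, u} A}

/-- Compatibility of the constraint with 2-cells. On bases `α` is an `eqToHom`; on carriers, after
the unit of the reflection, what remains is naturality of `α` at the arrow from `e` to its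
reflection. -/
lemma comp₂_compareHom {F G : Hom P Q} (α : F ⟶ G) (e : P.obj) :
    Q.compare.map (comp₂ α e) ≫ G.compareHom e =
      F.compareHom e ≫ (map₂Comonad α).mapTotal.app (P.compare.obj e) := by
  apply Total.hom_ext
  · change Q.p.map (comp₂ α e) ≫ eqToHom (G.w_obj e) = eqToHom (F.w_obj e) ≫ 𝟙 _
    rw [comp₂_base]
    simp
  · change Q.isPruned.refl.map (comp₂ α e) ≫ (G.reflIso e).hom =
      (F.reflIso e).hom ≫ (fibNatTrans α).app (P.isPruned.refl.obj e)
    apply Q.isPruned.isOpfibration.unit_ext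
    rw [CategoryTheory.Functor.map_comp, IsOpfibration.unit_nat_assoc, Hom.unit_reflIso,
      CategoryTheory.Functor.map_comp, Hom.unit_reflIso_assoc, mapIncl_comp₂]

lemma id_reflIso (e : P.obj) : ((Hom.id P).reflIso e).hom = 𝟙 (P.isPruned.refl.obj e) :=
  P.isPruned.isOpfibration.unit_ext (((Hom.id P).unit_reflIso e).trans
    ((congrArg (P.isPruned.unit e ≫ ·) ((incl P.p).map_id _)).trans (Category.comp_id _)).symm)

/-- After the unit of the reflection both sides are the image under `K` of `H.mapUnit e`, which is
by definition the arrow `mapUnit` of the composite. -/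
lemma comp_reflIso (H : Hom P Q) (K : Hom Q R) (e : P.obj) :
    ((H.comp K).reflIso e).hom =
      (K.reflIso (H.functor.obj e)).hom ≫ K.fib.map (H.reflIso e).hom := by
  refine R.isPruned.isOpfibration.unit_ext (((H.comp K).unit_reflIso e).trans ?_)
  refine Eq.trans ?_ (congrArg (R.isPruned.unit (K.functor.obj (H.functor.obj e)) ≫ ·)
    ((incl R.p).map_comp (K.reflIso (H.functor.obj e)).hom (K.fib.map (H.reflIso e).hom))).symm
  refine Eq.trans ?_ (K.unit_reflIso_assoc (H.functor.obj e) _).symm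
  exact ((K.mapIncl_fib (Q.isPruned.unit (H.functor.obj e)) (H.reflIso e).hom).trans
    (congrArg K.functor.map (H.unit_reflIso e))).symm

end

variable (A) in
/-- The comparison morphisms form a strong transformation. -/
noncomputable def comparisonTrans :
    Pseudofunctor.StrongTrans
        (Pseudofunctor.id (PrunedOpfib.{v₁, u₁, max v₁ v, max u₁ u v₁ v} A))
        ((assocComonad.{v₁, u₁, max v₁ v, max u₁ u v₁ v} A).comp
          (PrunedComonad.coEM.{v₁, u₁, max v₁ v, max u₁ u v₁ v} A)) where
  app P := comparison.{v₁, u₁, v, u} P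
  naturality H := comparisonNaturality H
  naturality_naturality {P Q F G} α := hom₂_ext fun e => comp₂_compareHom α e
  naturality_id P := hom₂_ext fun (e : P.obj) => Total.hom_ext
    (by
      change 𝟙 (P.p.obj e) ≫ (𝟙 (P.p.obj e) ≫ 𝟙 (P.p.obj e)) =
        P.p.map (𝟙 e) ≫ 𝟙 (P.p.obj e) ≫ 𝟙 (P.p.obj e)
      simp)
    (by
      change ((Hom.id P).reflIso e).hom ≫ 𝟙 (P.isPruned.refl.obj e) ≫ 𝟙 (P.isPruned.refl.obj e) =
        P.isPruned.refl.map (𝟙 e) ≫ 𝟙 (P.isPruned.refl.obj e) ≫ 𝟙 (P.isPruned.refl.obj e)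
      refine (congrArg (fun f : P.isPruned.refl.obj e ⟶ P.isPruned.refl.obj e =>
        f ≫ 𝟙 _ ≫ 𝟙 _) ((id_reflIso e).trans (P.isPruned.refl.map_id e).symm)))
  naturality_comp {P Q R} F G := hom₂_ext fun (e : P.obj) => Total.hom_ext
    (by
      change eqToHom ((Hom.comp F G).w_obj e) ≫ 𝟙 (P.p.obj e) ≫ 𝟙 (P.p.obj e) =
        R.p.map (𝟙 ((Hom.functor G).obj ((Hom.functor F).obj e))) ≫
          𝟙 (R.p.obj ((Hom.functor G).obj ((Hom.functor F).obj e))) ≫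
          eqToHom (Hom.w_obj G ((Hom.functor F).obj e)) ≫
          𝟙 (Q.p.obj ((Hom.functor F).obj e)) ≫
          eqToHom (Hom.w_obj F e) ≫ 𝟙 (P.p.obj e)
      simp
      rfl)
    (by
      -- The composition constraints of both pseudofunctors, and all associators, are identities on
      -- carriers, so the coherence law comes down to `comp_reflIso`.
      let Z := (Hom.fib G).obj ((Hom.fib F).obj (P.isPruned.refl.obj e))
      let W := (Hom.fib G).obj (Q.isPruned.refl.obj ((Hom.functor F).obj e))
      let V := (Hom.functor G).obj ((Hom.functor F).obj e)
      change ((Hom.comp F G).reflIso e).hom ≫ 𝟙 Z ≫ 𝟙 Z =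
        R.isPruned.refl.map (𝟙 V) ≫ 𝟙 (R.isPruned.refl.obj V) ≫
          (Hom.reflIso G ((Hom.functor F).obj e)).hom ≫ 𝟙 W ≫
            (Hom.fib G).map (Hom.reflIso F e).hom ≫ 𝟙 Z
      rw [CategoryTheory.Functor.map_id, Category.id_comp, Category.id_comp, Category.id_comp,
        Category.comp_id]
      exact (congrArg (((Hom.comp F G).reflIso e).hom ≫ ·) (Category.comp_id (𝟙 Z))).trans
        ((Category.comp_id _).trans (comp_reflIso F G e)))

end PrunedOpfib

/-! ### Arrows of cofree coalgebras and full faithfulness on coalgebras -/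

namespace ParamComonad

variable {A : Type u₁} [Category.{v₁} A] {S T : ParamComonad.{v₁, u₁, v, u} A}

/-- The arrow of cofree coalgebras induced by an arrow of the base and an arrow of carriers. -/
def cofreeMap {a b : A} (f : a ⟶ b) {Y Z : S.carrier} (g : Y ⟶ Z) :
    S.cofree a Y ⟶ S.cofree b Z where
  base := f
  carrier := (S.comonad.map f).app Y ≫ (S.comonad.obj b).map g
  comm := by
    change ((S.comonad.obj a).δ.app Y ≫ (S.comonad.map f).app _) ≫
        (S.comonad.obj b).map ((S.comonad.map f).app Y ≫ (S.comonad.obj b).map g) =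
      ((S.comonad.map f).app Y ≫ (S.comonad.obj b).map g) ≫ (S.comonad.obj b).δ.app Z
    simp only [Category.assoc, Comonad.delta_naturality, ComonadHom.app_δ_assoc,
      CategoryTheory.Functor.map_comp]

lemma cofreeMap_counit {a b : A} (f : a ⟶ b) {Y Z : S.carrier} (g : Y ⟶ Z) :
    Total.Hom.carrier (cofreeMap f g) ≫ (S.comonad.obj b).ε.app Z =
      (S.comonad.obj a).ε.app Y ≫ g := by
  change ((S.comonad.map f).app Y ≫ (S.comonad.obj b).map g) ≫ (S.comonad.obj b).ε.app Z = _
  rw [Category.assoc, Comonad.counit_naturality, ComonadHom.app_ε_assoc]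

lemma Hom.mapTotal_faithful (F : Hom S T) [F.functor.Faithful] : F.mapTotal.Faithful where
  map_injective {M N φ ψ} h := Total.hom_ext
    (show Total.Hom.base (F.mapTotal.map φ) = Total.Hom.base (F.mapTotal.map ψ) by rw [h])
    (F.functor.map_injective
      (show Total.Hom.carrier (F.mapTotal.map φ) = Total.Hom.carrier (F.mapTotal.map ψ) by rw [h]))

/-- The carrier of an arrow lifts by fullness. That the lift is an arrow of coalgebras may be tested
after applying `F.functor` and then the structure arrow of `F`, which is a monomorphism; there it is
the coalgebra condition on the given arrow. -/
lemma Hom.mapTotal_full (F : Hom S T) [F.functor.Full] [F.functor.Faithful]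
    [∀ a Y, IsIso (F.dist a Y)] : F.mapTotal.Full where
  map_surjective {M N} φ := by
    obtain ⟨g, hg⟩ := F.functor.map_surjective (X := M.coalg.A) (Y := N.coalg.A)
      (Total.Hom.carrier (M := F.mapObj M) (N := F.mapObj N) φ)
    refine ⟨{ base := Total.Hom.base (M := F.mapObj M) (N := F.mapObj N) φ,
              carrier := g, comm := ?_ }, Total.hom_ext rfl hg⟩
    apply F.functor.map_injective
    rw [← cancel_mono (F.dist _ _)]
    have h := Total.Hom.comm (M := F.mapObj M) (N := F.mapObj N) φ
    rw [← hg] at h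
    change ((F.functor.map M.coalg.a ≫ F.dist M.base M.coalg.A) ≫
      (T.comonad.map (Total.Hom.base (M := F.mapObj M) (N := F.mapObj N) φ)).app
        (F.functor.obj M.coalg.A)) ≫
        (T.comonad.obj N.base).map (F.functor.map g) =
      F.functor.map g ≫ F.functor.map N.coalg.a ≫ F.dist N.base N.coalg.A at h
    rw [CategoryTheory.Functor.map_comp, CategoryTheory.Functor.map_comp,
      CategoryTheory.Functor.map_comp, Category.assoc, F.naturality, Category.assoc, Category.assoc,
      ← h]
    have hb := F.naturality_base (Total.Hom.base (M := F.mapObj M) (N := F.mapObj N) φ) M.coalg.A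
    simp only [Category.assoc]
    exact congrArg (F.functor.map M.coalg.a ≫ ·)
      ((Category.assoc _ _ _).symm.trans ((congrArg (· ≫ _) hb).trans (Category.assoc _ _ _)))

end ParamComonad

/-! ### The terminal fibre of the coEilenberg-Moore opfibration and the counit -/

namespace PrunedComonad

variable {A : Type u₁} [Category.{v₁} A] [HasTerminal A] (S : PrunedComonad.{v₁, u₁, v, u} A)

/-- The functor from the terminal fibre of the coEilenberg-Moore opfibration to the category of
carriers. -/
noncomputable def fiberForget : TermFiber (proj S.toParamComonad) ⥤ S.carrier :=
  incl (proj S.toParamComonad) ⋙ forget S.toParamComonad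

/-- An arrow between the carriers of coalgebras over the terminal object is an arrow of
coalgebras. -/
noncomputable def homOfCarrier {M N : Total S.toParamComonad} (hM : M.base = ⊤_ A)
    (hN : N.base = ⊤_ A) (g : M.coalg.A ⟶ N.coalg.A) : M ⟶ N where
  base := eqToHom (hM.trans hN.symm)
  carrier := g
  comm := by
    obtain ⟨a, M⟩ := M
    obtain ⟨b, N⟩ := N
    change a = ⊤_ A at hM
    change b = ⊤_ A at hN
    subst hM
    subst hN
    change (M.a ≫ (S.comonad.map (𝟙 _)).app M.A) ≫ (S.comonad.obj (⊤_ A)).map g = g ≫ N.a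
    -- The counit of `S_⊤` is invertible and can be cancelled; by the counit laws of the two
    -- coalgebras both sides then equal `g`.
    rw [map_app_id, Category.comp_id, ← cancel_mono ((S.comonad.obj (⊤_ A)).ε.app N.A),
      Category.assoc, Category.assoc, N.counit, Comonad.counit_naturality, M.counit_assoc,
      Category.comp_id]

instance : S.fiberForget.Faithful where
  map_injective {Y Z f g} h := fib_ext (Total.hom_ext (S.hom_base_ext Z.2 _ _) h)

instance : S.fiberForget.Full where
  map_surjective {Y Z} g := ⟨fibHom (S.homOfCarrier Y.2 Z.2 g), rfl⟩

/-- A preimage of `Y` is the cofree coalgebra over the terminal object: its carrier `S_⊤ Y` is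
isomorphic to `Y` through the counit. -/
instance : S.fiberForget.EssSurj where
  mem_essImage Y := ⟨⟨S.cofree (⊤_ A) Y, rfl⟩, 
    ⟨(show (S.comonad.obj (⊤_ A)).obj Y ≅ Y from
      have : IsIso ((S.comonad.obj (⊤_ A)).ε.app Y) := isIso_counit _ S.nonempty_iso.some Y
      asIso ((S.comonad.obj (⊤_ A)).ε.app Y))⟩⟩

instance : S.fiberForget.IsEquivalence where

/-- The category of carriers has an initial object if and only if the terminal fibre has one. -/
lemma hasInitial_iff : HasInitial S.carrier ↔ HasInitial (TermFiber (proj S.toParamComonad)) :=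
  S.fiberForget.asEquivalence.hasInitial_iff.symm

/-- The arrow from the product `r a × Y` to the cofree coalgebra over `a` on the carrier of `Y`. -/
noncomputable def toCofree (a : A) (Y : TermFiber (proj S.toParamComonad)) :
    S.isPruned_proj.prodObj a Y ⟶ S.cofree a (S.fiberForget.obj Y) :=
  cofreeLift (S.isPruned_proj.proj a Y) (Total.Hom.carrier (S.isPruned_proj.snd a Y))

lemma toCofree_base (a : A) (Y : TermFiber (proj S.toParamComonad)) :
    Total.Hom.base (S.toCofree a Y) = S.isPruned_proj.proj a Y := rfl

lemma toCofree_counit (a : A) (Y : TermFiber (proj S.toParamComonad)) :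
    Total.Hom.carrier (S.toCofree a Y) ≫ (S.comonad.obj a).ε.app (S.fiberForget.obj Y) =
      Total.Hom.carrier (S.isPruned_proj.snd a Y) :=
  cofreeLift_counit _ _

/-- Both objects have the universal property of `r a × Y`. The right adjoint used in `prodObj` is an
arbitrary choice, not necessarily `cofreeTerminal`, so the inverse is assembled from the
projections: its components are `𝟙 a` and the counit of `S_a`, regarded as an arrow `cofreeSnd` of
coalgebras. -/
instance (a : A) (Y : TermFiber (proj S.toParamComonad)) : IsIso (S.toCofree a Y) := by
  let k : S.cofree a (S.fiberForget.obj Y) ⟶ S.isPruned_proj.prodObj a Y :=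
    S.isPruned_proj.pair (𝟙 a) (S.cofreeSnd a ((incl _).obj Y) Y.2)
  have hk : Total.Hom.base k ≫ S.isPruned_proj.proj a Y = 𝟙 a := S.isPruned_proj.pair_proj _ _
  have hk' : k ≫ S.isPruned_proj.snd a Y = S.cofreeSnd a ((incl _).obj Y) Y.2 :=
    S.isPruned_proj.pair_snd _ _
  have h₁ : k ≫ S.toCofree a Y = 𝟙 _ := cofree_ext hk (by
    rw [Total.comp_carrier, Category.assoc, toCofree_counit]
    exact (congrArg Total.Hom.carrier hk').trans (Category.id_comp _).symm)
  refine ⟨k, S.isPruned_proj.pair_ext ?_ (Total.hom_ext (S.hom_base_ext Y.2 _ _) ?_), h₁⟩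
  · exact (Category.assoc (S.isPruned_proj.proj a Y) (Total.Hom.base k)
      (S.isPruned_proj.proj a Y)).trans ((congrArg (S.isPruned_proj.proj a Y ≫ ·) hk).trans
        ((Category.comp_id _).trans (Category.id_comp (S.isPruned_proj.proj a Y)).symm))
  · rw [Category.assoc, hk', Category.id_comp]
    exact S.toCofree_counit a Y

/-- The underlying arrow of carriers of the cocartesian arrow from `M` to its reflection. -/
noncomputable def unitCarrier (M : Total S.toParamComonad) :
    M.coalg.A ⟶ S.fiberForget.obj (S.isPruned_proj.refl.obj M) :=
  Total.Hom.carrier (S.isPruned_proj.unit M)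

instance (M : Total S.toParamComonad) : IsIso (S.unitCarrier M) :=
  isIso_of_cocartesian _ _ (S.isPruned_proj.isOpfibration.unit_cocartesian M)

lemma unitCarrier_nat {M N : Total S.toParamComonad} (f : M ⟶ N) :
    S.unitCarrier M ≫ S.fiberForget.map (S.isPruned_proj.refl.map f) =
      Total.Hom.carrier f ≫ S.unitCarrier N :=
  congrArg Total.Hom.carrier (S.isPruned_proj.isOpfibration.unit_nat f)

/-- The comonad of the coEilenberg-Moore opfibration of `S` agrees with `S`. -/
noncomputable def counitDist (a : A) (Y : TermFiber (proj S.toParamComonad)) :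
    S.fiberForget.obj (S.isPruned_proj.refl.obj (S.isPruned_proj.prodObj a Y)) ⟶
      (S.comonad.obj a).obj (S.fiberForget.obj Y) :=
  inv (S.unitCarrier (S.isPruned_proj.prodObj a Y)) ≫ Total.Hom.carrier (S.toCofree a Y)

instance (a : A) (Y : TermFiber (proj S.toParamComonad)) : IsIso (S.counitDist a Y) := by
  have : IsIso (Total.Hom.carrier (S.toCofree a Y)) :=
    inferInstanceAs (IsIso ((forget S.toParamComonad).map (S.toCofree a Y)))
  unfold counitDist
  infer_instance

/-- The way `counitDist` is computed with: once the invertible `unitCarrier` is put in front,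
identities become equalities of arrows into cofree coalgebras, which are decided on the base and
after the counit. -/
lemma unitCarrier_counitDist (a : A) (Y : TermFiber (proj S.toParamComonad)) :
    S.unitCarrier (S.isPruned_proj.prodObj a Y) ≫ S.counitDist a Y =
      Total.Hom.carrier (S.toCofree a Y) :=
  IsIso.hom_inv_id_assoc _ _

lemma prodMap_toCofree {a b : A} (f : a ⟶ b) {Y Z : TermFiber (proj S.toParamComonad)}
    (g : Y ⟶ Z) : S.isPruned_proj.prodMap f g ≫ S.toCofree b Z =
      S.toCofree a Y ≫ cofreeMap f (S.fiberForget.map g) := by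
  apply cofree_ext
  · exact S.isPruned_proj.prodMap_proj f g
  · rw [Total.comp_carrier, Total.comp_carrier, Category.assoc, Category.assoc, toCofree_counit,
      cofreeMap_counit, ← Category.assoc, toCofree_counit]
    exact congrArg Total.Hom.carrier (S.isPruned_proj.prodMap_snd f g)

/-- Naturality in both variables at once; `f = 𝟙 a` and `g = 𝟙 Y` give the two naturality axioms of
a morphism of parametrized comonads. -/
lemma counitDist_nat {a b : A} (f : a ⟶ b) {Y Z : TermFiber (proj S.toParamComonad)}
    (g : Y ⟶ Z) :
    S.fiberForget.map (S.isPruned_proj.refl.map (S.isPruned_proj.prodMap f g)) ≫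
        S.counitDist b Z =
      S.counitDist a Y ≫ (S.comonad.map f).app _ ≫
        (S.comonad.obj b).map (S.fiberForget.map g) := by
  rw [← cancel_epi (S.unitCarrier _), ← Category.assoc, unitCarrier_nat, Category.assoc,
    unitCarrier_counitDist, ← Category.assoc (S.unitCarrier _), unitCarrier_counitDist]
  exact congrArg Total.Hom.carrier (S.prodMap_toCofree f g)

/-- The pairing on the left is the arrow whose reflection is the comultiplication, by
`IsPruned.δ_eq`. Its description as an arrow into a cofree coalgebra is what the comultiplication
axiom for `counitDist` needs. -/
lemma pair_toCofree (a : A) (Y : TermFiber (proj S.toParamComonad)) :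
    S.isPruned_proj.pair (S.isPruned_proj.proj a Y)
        (S.isPruned_proj.unit (S.isPruned_proj.prodObj a Y)) ≫ S.toCofree a _ =
      cofreeLift (S.isPruned_proj.proj a Y) (S.unitCarrier (S.isPruned_proj.prodObj a Y)) := by
  apply cofree_ext
  · exact S.isPruned_proj.pair_proj _ _
  · rw [Total.comp_carrier, Category.assoc, toCofree_counit]
    exact (congrArg Total.Hom.carrier (S.isPruned_proj.pair_snd _ _)).trans
      (cofreeLift_counit _ _).symm

lemma counitDist_ε (a : A) (Y : TermFiber (proj S.toParamComonad)) :
    S.counitDist a Y ≫ (S.comonad.obj a).ε.app (S.fiberForget.obj Y) =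
      S.fiberForget.map (S.isPruned_proj.ε a Y) := by
  rw [← cancel_epi (S.unitCarrier _), ← Category.assoc, unitCarrier_counitDist, toCofree_counit]
  exact (congrArg Total.Hom.carrier (S.isPruned_proj.unit_ε a Y)).symm

lemma counitDist_δ (a : A) (Y : TermFiber (proj S.toParamComonad)) :
    S.counitDist a Y ≫ (S.comonad.obj a).δ.app (S.fiberForget.obj Y) =
      S.fiberForget.map (S.isPruned_proj.δ a Y) ≫
        S.counitDist a (S.isPruned_proj.refl.obj (S.isPruned_proj.prodObj a Y)) ≫
          (S.comonad.obj a).map (S.counitDist a Y) := by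
  rw [← cancel_epi (S.unitCarrier _), ← Category.assoc, unitCarrier_counitDist, IsPruned.δ_eq,
    ← Category.assoc (S.unitCarrier _), unitCarrier_nat, Category.assoc,
    ← Category.assoc (S.unitCarrier _), unitCarrier_counitDist, ← Category.assoc,
    ← Total.comp_carrier, pair_toCofree]
  -- The structure map of a cofree coalgebra is the comultiplication of `S_a`, so the left side is
  -- one half of the coalgebra condition on `toCofree`.
  refine (Total.Hom.comm (S.toCofree a Y)).symm.trans ?_
  rw [← unitCarrier_counitDist, CategoryTheory.Functor.map_comp, toCofree_base]
  simp only [cofreeLift, Category.assoc]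

end PrunedComonad

/-! ### Recovering the structure of a morphism along a section -/

namespace ParamComonad

variable {A : Type u₁} [Category.{v₁} A] {S T : ParamComonad.{v₁, u₁, v, u} A}

/-- The structure 2-cell of a morphism at `Y` is determined by its value at `X`, for every section
`k` of the arrow `S_b X ⟶ S_a Y` induced by arrows `b ⟶ a` and `X ⟶ Y`. -/
lemma Hom.dist_eq_of_section (F : Hom S T) {a b : A} (f : b ⟶ a) {X Y : S.carrier} (g : X ⟶ Y)
    (k : (S.comonad.obj a).obj Y ⟶ (S.comonad.obj b).obj X)
    (hk : k ≫ (S.comonad.map f).app X ≫ (S.comonad.obj a).map g = 𝟙 _) :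
    F.dist a Y = F.functor.map k ≫ F.dist b X ≫ (T.comonad.map f).app (F.functor.obj X) ≫
      (T.comonad.obj a).map (F.functor.map g) := by
  rw [← reassoc_of% (F.naturality_base f X), ← F.naturality, ← Functor.map_comp_assoc,
    ← Functor.map_comp_assoc, Category.assoc, hk, CategoryTheory.Functor.map_id, Category.id_comp]

/-- The structure arrows of `F` and `G` at `(a, Y)` are both obtained from those at `(b, X)` by the
same recipe, so compatibility propagates. The hypothesis `h` asks for it only after `k`; when `k` is
a coalgebra structure on an object with carrier `X`, this is the condition for an arrow of
coalgebras. -/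
lemma Hom.comm_of_section (F G : Hom S T) {a b : A} (f : b ⟶ a) {X Y : S.carrier} (g : X ⟶ Y)
    (k : (S.comonad.obj a).obj Y ⟶ (S.comonad.obj b).obj X)
    (hk : k ≫ (S.comonad.map f).app X ≫ (S.comonad.obj a).map g = 𝟙 _)
    {s : F.functor.obj ((S.comonad.obj a).obj Y) ⟶ G.functor.obj ((S.comonad.obj a).obj Y)}
    {x : F.functor.obj X ⟶ G.functor.obj X} {y : F.functor.obj Y ⟶ G.functor.obj Y}
    (hg : F.functor.map g ≫ y = x ≫ G.functor.map g)
    (h : (F.functor.map k ≫ F.dist b X) ≫ (T.comonad.obj b).map x =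
      s ≫ G.functor.map k ≫ G.dist b X) :
    F.dist a Y ≫ (T.comonad.obj a).map y = s ≫ G.dist a Y := by
  rw [Category.assoc] at h
  rw [F.dist_eq_of_section f g k hk, G.dist_eq_of_section f g k hk, ← reassoc_of% h]
  simp only [Category.assoc]
  rw [← CategoryTheory.Functor.map_comp, hg, CategoryTheory.Functor.map_comp,
    map_app_naturality_assoc]

end ParamComonad

/-! ### A triangle of the biadjunction, and the comparison of a coEilenberg-Moore opfibration -/

namespace PrunedComonad

variable {A : Type u₁} [Category.{v₁} A] [HasTerminal A]

variable (S : PrunedComonad.{v₁, u₁, v, u} A)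

/-- The arrow `g` is the graph of `M`, given through its two components. Followed by the isomorphism
from the product to the cofree coalgebra, it is the lift of `𝟙` and `unitCarrier`, whose carrier is
the structure map of `M` followed by the image of `unitCarrier`. Hence `unitCarrier` is an arrow of
coalgebras from `M` to the image, under the counit, of its comparison coalgebra. -/
lemma unit_counit_comm {M : Total S.toParamComonad}
    {g : M ⟶ S.isPruned_proj.prodObj M.base (S.isPruned_proj.refl.obj M)}
    (h₁ : Total.Hom.base g ≫ S.isPruned_proj.proj _ _ = 𝟙 M.base)
    (h₂ : g ≫ S.isPruned_proj.snd _ _ = S.isPruned_proj.unit M) :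
    M.coalg.a ≫ (S.comonad.obj M.base).map (S.unitCarrier M) =
      S.unitCarrier M ≫ S.fiberForget.map (S.isPruned_proj.refl.map g) ≫
        S.counitDist M.base (S.isPruned_proj.refl.obj M) := by
  have h : g ≫ S.toCofree M.base (S.isPruned_proj.refl.obj M) =
      cofreeLift (𝟙 M.base) (S.unitCarrier M) := by
    apply cofree_ext
    · exact h₁
    · rw [Total.comp_carrier, Category.assoc, toCofree_counit, cofreeLift_counit]
      exact congrArg Total.Hom.carrier h₂
  rw [← Category.assoc, unitCarrier_nat, Category.assoc, unitCarrier_counitDist,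
    ← Total.comp_carrier, h]
  simp only [cofreeLift, map_app_id]
  exact congrArg (M.coalg.a ≫ ·) (Category.id_comp _).symm

end PrunedComonad

namespace PrunedComonad

variable {A : Type u₁} [Category.{v₁} A] [HasTerminal A]

variable (S : PrunedComonad.{v₁, u₁, max v₁ v, max u₁ u v₁ v} A)

/-- The counit of the biadjunction: the comonad of the coEilenberg-Moore opfibration of `S` maps
to `S`. -/
noncomputable def counitHom : ParamComonad.Hom S.toOpfib.toComonad.toParamComonad
    S.toParamComonad where
  functor := S.fiberForget
  dist a Y := S.counitDist a Y
  naturality a Y Z g := (S.counitDist_nat (𝟙 a) g).trans (by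
    rw [map_app_id]
    exact congrArg (S.counitDist a Y ≫ ·) (Category.id_comp _))
  naturality_base {a b} f Y := (S.counitDist_nat f (𝟙 Y)).trans (by
    rw [CategoryTheory.Functor.map_id, CategoryTheory.Functor.map_id, Category.comp_id]
    rfl)
  counit a Y := S.counitDist_ε a Y
  comult a Y := S.counitDist_δ a Y

/-- The component at a coalgebra of the isomorphism in a triangle of the biadjunction. -/
noncomputable def unitCounitHom (M : Total S.toParamComonad) :
    M ⟶ (counitHom.{v₁, u₁, v, u} S).mapTotal.obj (S.toOpfib.compare.obj M) where
  base := 𝟙 M.base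
  carrier := S.unitCarrier M
  comm := by
    refine Eq.trans ?_
      (S.unit_counit_comm (S.toOpfib.graph_proj M) (S.toOpfib.graph_snd M))
    change (M.coalg.a ≫ (S.comonad.map (𝟙 M.base)).app M.coalg.A) ≫
      (S.comonad.obj M.base).map (S.unitCarrier M) =
        M.coalg.a ≫ (S.comonad.obj M.base).map (S.unitCarrier M)
    rw [map_app_id]
    exact congrArg (· ≫ _) (Category.comp_id _)

instance isIso_unitCounitHom (M : Total S.toParamComonad) :
    IsIso (unitCounitHom.{v₁, u₁, v, u} S M) :=
  have : IsIso (Total.Hom.base (unitCounitHom.{v₁, u₁, v, u} S M)) :=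
    inferInstanceAs (IsIso (𝟙 M.base))
  have : IsIso (Total.Hom.carrier (unitCounitHom.{v₁, u₁, v, u} S M)) :=
    inferInstanceAs (IsIso (S.unitCarrier M))
  Total.isIso_of_isIso _

/-- The comparison functor of a coEilenberg-Moore opfibration is a section, up to isomorphism, of
the functor induced by the counit. -/
noncomputable def unitCounitNatIso : 𝟭 (Total S.toParamComonad) ≅
    S.toOpfib.compare ⋙ (counitHom.{v₁, u₁, v, u} S).mapTotal :=
  NatIso.ofComponents (F := 𝟭 (Total S.toParamComonad))
    (G := S.toOpfib.compare ⋙ (counitHom.{v₁, u₁, v, u} S).mapTotal)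
    (fun M => @asIso _ _ _ _ _ (isIso_unitCounitHom.{v₁, u₁, v, u} S M))
    (fun {M N} f => Total.hom_ext
      ((Category.comp_id (Total.Hom.base f)).trans (Category.id_comp (Total.Hom.base f)).symm)
      (S.unitCarrier_nat f).symm)

/-- Full faithfulness comes from that of `fiberForget` and the invertibility of `counitDist`.
Essential surjectivity comes from the triangle: each `M` is isomorphic to the image of its
comparison coalgebra. -/
instance : (counitHom.{v₁, u₁, v, u} S).mapTotal.IsEquivalence := by
  have : (counitHom.{v₁, u₁, v, u} S).functor.Faithful := inferInstanceAs S.fiberForget.Faithful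
  have : (counitHom.{v₁, u₁, v, u} S).functor.Full := inferInstanceAs S.fiberForget.Full
  have (a) (Y) : IsIso ((counitHom.{v₁, u₁, v, u} S).dist a Y) :=
    inferInstanceAs (IsIso (S.counitDist a Y))
  have := (counitHom.{v₁, u₁, v, u} S).mapTotal_faithful
  have := (counitHom.{v₁, u₁, v, u} S).mapTotal_full
  exact { essSurj := ⟨fun M => ⟨_, ⟨((unitCounitNatIso.{v₁, u₁, v, u} S).app M).symm⟩⟩⟩ }

/-- The comparison functor of a coEilenberg-Moore opfibration is an equivalence. -/
instance isEquivalence_compare : S.toOpfib.compare.IsEquivalence :=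
  have : (S.toOpfib.compare ⋙ (counitHom.{v₁, u₁, v, u} S).mapTotal).IsEquivalence :=
    Functor.isEquivalence_of_iso (unitCounitNatIso.{v₁, u₁, v, u} S)
  Functor.isEquivalence_of_comp_right _ (counitHom.{v₁, u₁, v, u} S).mapTotal

/-- A triangle of the biadjunction. -/
noncomputable def triangleIso : 𝟙 ((coEM A).obj S) ≅
    PrunedOpfib.comparison.{v₁, u₁, v, u} ((coEM A).obj S) ≫
      (coEM A).map (counitHom.{v₁, u₁, v, u} S) :=
  PrunedOpfib.isoMk (F := PrunedOpfib.Hom.id S.toOpfib)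
    (G := PrunedOpfib.Hom.comp (PrunedOpfib.comparison.{v₁, u₁, v, u} ((coEM A).obj S))
      (mapOpfib (counitHom.{v₁, u₁, v, u} S)))
    (BasedNatIso.mkNatIso (unitCounitNatIso.{v₁, u₁, v, u} S)
      (fun M => isHomLift_base (unitCounitHom.{v₁, u₁, v, u} S M)))

end PrunedComonad

/-! ### 2-cells determined on reflections -/

namespace PrunedOpfib

variable {A : Type u₁} [Category.{v₁} A] [HasTerminal A]

section

variable (P : PrunedOpfib.{v₁, u₁, v, u} A)

/-- An object of the terminal fibre is isomorphic to its reflection. -/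
noncomputable def reflInclIso (Y : TermFiber P.p) : Y ≅ P.isPruned.refl.obj ((incl P.p).obj Y) where
  hom := fibHom (P.isPruned.unit ((incl P.p).obj Y))
  inv := P.isPruned.desc (𝟙 ((incl P.p).obj Y))
  hom_inv_id := Opfib.fib_ext (by
    rw [CategoryTheory.Functor.map_comp, incl_map_fibHom, IsOpfibration.unit_desc,
      CategoryTheory.Functor.map_id])
  inv_hom_id := P.isPruned.isOpfibration.unit_ext (by
    rw [CategoryTheory.Functor.map_comp, ← Category.assoc, IsOpfibration.unit_desc,
      incl_map_fibHom, CategoryTheory.Functor.map_id, Category.id_comp, Category.comp_id])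

lemma reflInclIso_nat {Y Z : TermFiber P.p} (g : Y ⟶ Z) :
    g ≫ (P.reflInclIso Z).hom =
      (P.reflInclIso Y).hom ≫ P.isPruned.refl.map ((incl P.p).map g) :=
  Opfib.fib_ext (by
    rw [CategoryTheory.Functor.map_comp, CategoryTheory.Functor.map_comp]
    exact (P.isPruned.isOpfibration.unit_nat ((incl P.p).map g)).symm)

lemma reflInclIso_inv_nat {Y Z : TermFiber P.p} (g : Y ⟶ Z) :
    P.isPruned.refl.map ((incl P.p).map g) ≫ (P.reflInclIso Z).inv =
      (P.reflInclIso Y).inv ≫ g := by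
  rw [Iso.comp_inv_eq, Category.assoc, reflInclIso_nat, Iso.inv_hom_id_assoc]

/-- The reflection is idempotent: this is naturality of the unit at the unit itself. -/
lemma refl_map_unit (e : P.obj) :
    P.isPruned.refl.map (P.isPruned.unit e) =
      (P.reflInclIso (P.isPruned.refl.obj e)).hom :=
  P.isPruned.isOpfibration.unit_ext (P.isPruned.isOpfibration.unit_nat (P.isPruned.unit e))

/-- A triangle identity of the adjunction between `⟨p, refl⟩` and the product functor: `graph` is
its unit, and its counit has components `proj` and `ε`. -/
lemma graph_prodMap (a : A) (Y : TermFiber P.p) :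
    P.graph (P.isPruned.prodObj a Y) ≫
      P.isPruned.prodMap (P.isPruned.proj a Y) (P.isPruned.ε a Y) = 𝟙 _ := by
  apply P.isPruned.pair_ext
  · rw [CategoryTheory.Functor.map_comp, Category.assoc, IsPruned.prodMap_proj,
      reassoc_of% (P.graph_proj (P.isPruned.prodObj a Y)), CategoryTheory.Functor.map_id,
      Category.id_comp]
  · rw [Category.assoc, IsPruned.prodMap_snd, reassoc_of% (P.graph_snd (P.isPruned.prodObj a Y)),
      IsPruned.unit_ε, Category.id_comp]

/-- The reflection of the preceding triangle identity. The comparison coalgebra structure of `e = r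
a × Y` is a section of the arrow `S_(p e) (S_a Y) ⟶ S_a Y` induced by `proj` and `ε`, as
`Hom.comm_of_section` requires. -/
lemma graph_section (a : A) (Y : TermFiber P.p) :
    P.isPruned.refl.map (P.graph (P.isPruned.prodObj a Y)) ≫
      (P.toComonad.comonad.map (P.isPruned.proj a Y)).app _ ≫
        (P.toComonad.comonad.obj a).map (P.isPruned.ε a Y) =
      𝟙 ((P.toComonad.comonad.obj a).obj Y) := by
  change P.isPruned.refl.map (P.graph (P.isPruned.prodObj a Y)) ≫
    P.isPruned.refl.map (P.isPruned.prodMap (P.isPruned.proj a Y) (𝟙 _)) ≫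
      P.isPruned.refl.map (P.isPruned.prodMap (𝟙 a) (P.isPruned.ε a Y)) =
        𝟙 (P.isPruned.refl.obj (P.isPruned.prodObj a Y))
  rw [← CategoryTheory.Functor.map_comp, ← CategoryTheory.Functor.map_comp]
  refine Eq.trans (congrArg P.isPruned.refl.map ?_) (P.isPruned.refl.map_id _)
  refine Eq.trans (congrArg (P.graph _ ≫ ·) ?_) (P.graph_prodMap a Y)
  -- Changing the base and then the carrier amounts to one arrow of products.
  apply P.isPruned.pair_ext <;> simp

end

section

variable {P : PrunedOpfib.{v₁, u₁, v, u} A} {S : ParamComonad.{v₁, u₁, v, u} A}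
  {F G : ParamComonad.Hom P.toComonad.toParamComonad S}
  (t : ∀ e : P.obj, F.functor.obj (P.isPruned.refl.obj e) ⟶
    G.functor.obj (P.isPruned.refl.obj e))

/-- A family of arrows indexed by the objects of the total category, restricted to the terminal
fibre. -/
noncomputable def restrict (Y : TermFiber P.p) : F.functor.obj Y ⟶ G.functor.obj Y :=
  F.functor.map (P.reflInclIso Y).hom ≫ t ((incl P.p).obj Y) ≫ G.functor.map (P.reflInclIso Y).inv

variable {t}

lemma restrict_nat
    (ht : ∀ {e e' : P.obj} (f : e ⟶ e'), F.functor.map (P.isPruned.refl.map f) ≫ t e' =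
      t e ≫ G.functor.map (P.isPruned.refl.map f))
    {Y Z : TermFiber P.p} (g : Y ⟶ Z) :
    F.functor.map g ≫ restrict t Z = restrict t Y ≫ G.functor.map g := by
  rw [restrict, restrict, ← Functor.map_comp_assoc, reflInclIso_nat, Functor.map_comp_assoc,
    Category.assoc, Category.assoc, ← CategoryTheory.Functor.map_comp, ← reflInclIso_inv_nat,
    reassoc_of% (ht ((incl P.p).map g)), CategoryTheory.Functor.map_comp]

/-- Naturality of `t` at the arrow from `e` to its reflection, together with `refl_map_unit`: a
natural family loses nothing when it is restricted to the terminal fibre. -/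
lemma restrict_refl
    (ht : ∀ {e e' : P.obj} (f : e ⟶ e'), F.functor.map (P.isPruned.refl.map f) ≫ t e' =
      t e ≫ G.functor.map (P.isPruned.refl.map f))
    (e : P.obj) : restrict t (P.isPruned.refl.obj e) = t e := by
  rw [restrict, ← refl_map_unit, reassoc_of% (ht (P.isPruned.unit e)),
    ← CategoryTheory.Functor.map_comp, refl_map_unit, Iso.hom_inv_id,
    CategoryTheory.Functor.map_id, Category.comp_id]

/-- The coalgebra conditions `hc` at the objects `r a × Y` suffice: each gives compatibility at `(p
(r a × Y), S_a Y)` after the graph, and `graph_section` carries it over to `(a, Y)`. -/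
lemma restrict_comm
    (ht : ∀ {e e' : P.obj} (f : e ⟶ e'), F.functor.map (P.isPruned.refl.map f) ≫ t e' =
      t e ≫ G.functor.map (P.isPruned.refl.map f))
    (hc : ∀ e : P.obj,
      (F.functor.map (P.isPruned.refl.map (P.graph e)) ≫
        F.dist (P.p.obj e) (P.isPruned.refl.obj e)) ≫ (S.comonad.obj (P.p.obj e)).map (t e) =
      t e ≫ G.functor.map (P.isPruned.refl.map (P.graph e)) ≫
        G.dist (P.p.obj e) (P.isPruned.refl.obj e)) (a : A) (Y : TermFiber P.p) :
    F.dist a Y ≫ (S.comonad.obj a).map (restrict t Y) =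
      restrict t (P.isPruned.refl.obj (P.isPruned.prodObj a Y)) ≫ G.dist a Y := by
  refine F.comm_of_section G (P.isPruned.proj a Y) (P.isPruned.ε a Y) _ (P.graph_section a Y)
    (restrict_nat ht _) ?_
  have h := hc (P.isPruned.prodObj a Y)
  rw [← restrict_refl ht] at h
  exact h

end

/-! ### Transposition is an equivalence of categories -/

variable (P : PrunedOpfib.{v₁, u₁, max v₁ v, max u₁ u v₁ v} A)
  (S : PrunedComonad.{v₁, u₁, max v₁ v, max u₁ u v₁ v} A)

/-- The functor from morphisms out of the comonad of `P` to morphisms into the coEilenberg-Moore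
opfibration of `S`. -/
noncomputable abbrev transpose :
    ((assocComonad A).obj P ⟶ S) ⥤ (P ⟶ (PrunedComonad.coEM A).obj S) :=
  (PrunedComonad.coEM A).mapFunctor ((assocComonad A).obj P) S ⋙
    Bicategory.precomp ((PrunedComonad.coEM A).obj S) (comparison.{v₁, u₁, v, u} P)

/-- The transpose shows the components of a 2-cell at reflections, and by `reflInclIso` each `Y` in
the terminal fibre is isomorphic to a reflection; naturality does the rest. -/
lemma transpose_faithful : (transpose.{v₁, u₁, v, u} P S).Faithful where
  map_injective {F G α β} h := by
    apply ParamComonad.hom₂_ext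
    intro (Y : TermFiber P.p)
    have h' : α.trans.app (P.isPruned.refl.obj ((incl P.p).obj Y)) =
        β.trans.app (P.isPruned.refl.obj ((incl P.p).obj Y)) :=
      congrArg (fun γ => Total.Hom.carrier (app γ ((incl P.p).obj Y))) h
    refine (cancel_mono ((ParamComonad.Hom.functor G).mapIso (P.reflInclIso Y)).hom).1 ?_
    refine (α.trans.naturality (P.reflInclIso Y).hom).symm.trans
      (Eq.trans ?_ (β.trans.naturality (P.reflInclIso Y).hom))
    exact congrArg (_ ≫ ·) h'

/-- The carriers of the components of `τ` form a natural family at reflections, whose restriction to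
the terminal fibre is the required 2-cell. -/
lemma transpose_full : (transpose.{v₁, u₁, v, u} P S).Full where
  map_surjective {F G} τ := by
    let t (e : P.obj) : F.functor.obj (P.isPruned.refl.obj e) ⟶
        G.functor.obj (P.isPruned.refl.obj e) := Total.Hom.carrier (app τ e)
    have ht {e e' : P.obj} (f : e ⟶ e') : F.functor.map (P.isPruned.refl.map f) ≫ t e' =
        t e ≫ G.functor.map (P.isPruned.refl.map f) :=
      congrArg Total.Hom.carrier ((BasedNatTrans.toNatTrans τ).naturality f)
    have hb (e : P.obj) : Total.Hom.base (app τ e) = 𝟙 (P.p.obj e) :=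
      base_of_isHomLift (S := S.toParamComonad) (app τ e) (𝟙 (P.p.obj e))
        (BasedNatTrans.isHomLift' τ e)
    -- Since `τ` is vertical, the base change in the coalgebra condition on its component is along
    -- an identity and disappears.
    have hc (e : P.obj) :
        (F.functor.map (P.isPruned.refl.map (P.graph e)) ≫
          F.dist (P.p.obj e) (P.isPruned.refl.obj e)) ≫ (S.comonad.obj (P.p.obj e)).map (t e) =
        t e ≫ G.functor.map (P.isPruned.refl.map (P.graph e)) ≫
          G.dist (P.p.obj e) (P.isPruned.refl.obj e) := by
      refine Eq.trans ?_ (Total.Hom.comm (app τ e))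
      refine congrArg (· ≫ (S.comonad.obj (P.p.obj e)).map (t e)) ?_
      have h : (S.comonad.map (Total.Hom.base (app τ e))).app
          (F.functor.obj (P.isPruned.refl.obj e)) = 𝟙 _ :=
        (congrArg (fun f : P.p.obj e ⟶ P.p.obj e => (S.comonad.map f).app _) (hb e)).trans
          (map_app_id _ _)
      exact ((congrArg (_ ≫ ·) h).trans (Category.comp_id _)).symm
    refine ⟨({ trans := { app := restrict t, naturality := fun Y Z g => restrict_nat ht g }
               comm := restrict_comm ht hc } : ParamComonad.Hom₂ F G), hom₂_ext fun e => ?_⟩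
    exact Total.hom_ext (hb e).symm (restrict_refl ht e)

/-- A preimage of `K` is `L K` followed by the counit `c`: naturality of the comparison turns `η_P ≫
R (L K) ≫ R c` into `K ≫ η ≫ R c`, with `η` now at `R S`, and the triangle removes `η ≫ R c`. -/
lemma transpose_essSurj : (transpose.{v₁, u₁, v, u} P S).EssSurj where
  mem_essImage K := by
    let L := assocComonad.{v₁, u₁, max v₁ v, max u₁ u v₁ v} A
    let R := PrunedComonad.coEM.{v₁, u₁, max v₁ v, max u₁ u v₁ v} A
    let c : L.obj (R.obj S) ⟶ S := PrunedComonad.counitHom.{v₁, u₁, v, u} S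
    exact ⟨L.map K ≫ c, ⟨Bicategory.whiskerLeftIso _ (R.mapComp (L.map K) c) ≪≫
      (Bicategory.associator _ _ _).symm ≪≫
      Bicategory.whiskerRightIso (comparisonNaturality.{v₁, u₁, v, u} K).symm (R.map c) ≪≫
      Bicategory.associator _ _ _ ≪≫
      Bicategory.whiskerLeftIso K (PrunedComonad.triangleIso.{v₁, u₁, v, u} S).symm ≪≫
      Bicategory.rightUnitor K⟩⟩

variable (A) in
/-- The comparison morphisms are the unit of a biadjunction. -/
lemma isBiadjunctionUnit_comparisonTrans :
    IsBiadjunctionUnit (assocComonad.{v₁, u₁, max v₁ v, max u₁ u v₁ v} A)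
      (PrunedComonad.coEM.{v₁, u₁, max v₁ v, max u₁ u v₁ v} A)
      (comparisonTrans.{v₁, u₁, v, u} A) := fun P S =>
  { full := transpose_full.{v₁, u₁, v, u} P S
    faithful := transpose_faithful.{v₁, u₁, v, u} P S
    essSurj := transpose_essSurj.{v₁, u₁, v, u} P S }

/-! ### Equivalences of categories over the base are equivalences of pruned opfibrations -/

section

variable {P Q : PrunedOpfib.{v₁, u₁, v, u} A} (H : Hom P Q)

/-- A fully faithful functor over the base reflects cocartesian arrows. -/
lemma Hom.cocartesian_of_map [H.functor.Full] [H.functor.Faithful] {e e' : P.obj} {a b : A}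
    (f : a ⟶ b) (φ : e ⟶ e') (h : Q.p.IsStronglyCocartesian f (H.functor.map φ)) :
    P.p.IsStronglyCocartesian f φ := by
  have : P.p.IsHomLift f φ := H.based.isHomLift_map f φ
  refine { universal_property' := fun {e''} g ψ hψ => ?_ }
  have hψ' : Q.p.IsHomLift (f ≫ g) (H.functor.map ψ) := H.based.preserves_isHomLift _ _
  -- The factorization is found in `Q` and lifted by fullness; faithfulness gives its equation and
  -- its uniqueness.
  obtain ⟨χ, ⟨hχ, hχ'⟩, huniq⟩ := IsStronglyCocartesian.universal_property Q.p f
    (H.functor.map φ) g (f ≫ g) rfl (H.functor.map ψ)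
  obtain ⟨χ, rfl⟩ := H.functor.map_surjective χ
  refine ⟨χ, ⟨H.based.isHomLift_map g χ, H.functor.map_injective ?_⟩, ?_⟩
  · rw [CategoryTheory.Functor.map_comp, hχ']
  · rintro χ' ⟨h₁, h₂⟩
    apply H.functor.map_injective
    exact huniq _ ⟨H.based.preserves_isHomLift _ _, by rw [← CategoryTheory.Functor.map_comp, h₂]⟩

/-- An essentially surjective morphism of opfibrations is essentially surjective on fibres. -/
lemma Hom.exists_vertIso [H.functor.EssSurj] (y : Q.obj) :
    ∃ (e : P.obj) (φ : H.functor.obj e ≅ y), Q.p.IsHomLift (𝟙 (Q.p.obj y)) φ.hom := by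
  let e₀ := H.functor.objPreimage y
  let ψ : H.functor.obj e₀ ≅ y := H.functor.objObjPreimageIso y
  -- The preimage `e₀` lies over an object that is only isomorphic to that of `y`. Pushing it
  -- forward along this isomorphism `f` replaces it by an isomorphic object in the right fibre.
  let f : P.p.obj e₀ ⟶ Q.p.obj y := eqToHom (H.w_obj e₀).symm ≫ Q.p.map ψ.hom
  obtain ⟨e, κ, hκ⟩ := P.isPruned.isOpfibration e₀ _ f
  have hκ' : IsIso κ := IsStronglyCocartesian.isIso_of_base_isIso P.p f κ
  have h : Q.p.IsHomLift f (H.functor.map κ) := H.based.preserves_isHomLift f κ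
  have hψ : Q.p.IsHomLift f ψ.hom := IsHomLift.of_fac _ _ _ (H.w_obj e₀) rfl (by simp [f])
  refine ⟨e, (asIso (H.functor.map κ)).symm ≪≫ ψ, ?_⟩
  have h' : Q.p.IsHomLift (inv f) (inv (H.functor.map κ)) := IsHomLift.inv Q.p f _
  have := IsHomLift.comp (p := Q.p) (inv f) f (inv (H.functor.map κ)) ψ.hom
  rw [IsIso.inv_hom_id] at this
  exact this

variable [H.functor.IsEquivalence]

/-- A preimage, in the same fibre, of an object under an equivalence over the base. -/
noncomputable def Hom.invObj (y : Q.obj) : P.obj := (H.exists_vertIso y).choose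

/-- The vertical isomorphism between an object and the image of its preimage. -/
noncomputable def Hom.invIso (y : Q.obj) : H.functor.obj (H.invObj y) ≅ y :=
  (H.exists_vertIso y).choose_spec.choose

instance (y : Q.obj) : Q.p.IsHomLift (𝟙 (Q.p.obj y)) (H.invIso y).hom :=
  (H.exists_vertIso y).choose_spec.choose_spec

/-- The functor inverse to an equivalence over the base. -/
noncomputable abbrev Hom.invFunctor : Q.obj ⥤ P.obj where
  obj y := H.invObj y
  map {y z} g := H.functor.preimage ((H.invIso y).hom ≫ g ≫ (H.invIso z).inv)
  map_id y := H.functor.map_injective (by simp)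
  map_comp f g := H.functor.map_injective (by simp)

lemma Hom.map_invFunctor {y z : Q.obj} (g : y ⟶ z) :
    H.functor.map (H.invFunctor.map g) = (H.invIso y).hom ≫ g ≫ (H.invIso z).inv :=
  H.functor.map_preimage _

/-- The image under `H` is `g` composed with vertical isomorphisms at both ends, and a functor over
the base reflects the property of lying over `f`. -/
lemma Hom.isHomLift_invFunctor {y z : Q.obj} (g : y ⟶ z) {a b : A} (f : a ⟶ b)
    [hg : Q.p.IsHomLift f g] : P.p.IsHomLift f (H.invFunctor.map g) := by
  obtain rfl : Q.p.obj y = a := IsHomLift.domain_eq Q.p f g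
  obtain rfl : Q.p.obj z = b := IsHomLift.codomain_eq Q.p f g
  have : Q.p.IsHomLift f (H.functor.map (H.invFunctor.map g)) := by
    rw [map_invFunctor]
    have h₁ : Q.p.IsHomLift f (g ≫ (H.invIso z).inv) :=
      IsHomLift.comp_lift_id_right' Q.p f g (Q.p.obj z) _
    exact IsHomLift.comp_lift_id_left' Q.p (Q.p.obj y) _ f _
  exact H.based.isHomLift_map f _

lemma Hom.invObj_w (y : Q.obj) : P.p.obj (H.invObj y) = Q.p.obj y :=
  (H.w_obj _).symm.trans (IsHomLift.domain_eq Q.p (𝟙 (Q.p.obj y)) (H.invIso y).hom)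

/-- The inverse of a morphism of opfibrations that is an equivalence of categories. -/
noncomputable def Hom.inverse : Hom Q P where
  based :=
    { toFunctor := H.invFunctor
      -- Commutation with the projections is strict because the preimages were chosen in the fibre
      -- of the given objects.
      w := CategoryTheory.Functor.ext H.invObj_w (fun y z g => by
        have := H.isHomLift_invFunctor g (Q.p.map g)
        exact IsHomLift.fac' P.p (Q.p.map g) (H.invFunctor.map g)) }
  cocartesian {y z a b} f φ h := by
    -- Being fully faithful, `H` reflects cocartesian arrows, and the image of the inverse functor
    -- on `φ` is `φ` between two vertical isomorphisms, which are cocartesian.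
    apply H.cocartesian_of_map
    obtain rfl : Q.p.obj y = a := IsHomLift.domain_eq Q.p f φ
    obtain rfl : Q.p.obj z = b := IsHomLift.codomain_eq Q.p f φ
    have h₁ : Q.p.IsStronglyCocartesian (𝟙 (Q.p.obj y)) (H.invIso y).hom :=
      IsStronglyCocartesian.of_isIso Q.p _ _
    have h₂ : Q.p.IsStronglyCocartesian (𝟙 (Q.p.obj z)) (H.invIso z).inv :=
      IsStronglyCocartesian.of_isIso Q.p _ _
    have h₃ : Q.p.IsStronglyCocartesian (𝟙 _ ≫ f ≫ 𝟙 _)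
      ((H.invIso y).hom ≫ φ ≫ (H.invIso z).inv) := inferInstance
    rw [Category.id_comp, Category.comp_id] at h₃
    exact (H.map_invFunctor φ).symm ▸ h₃

/-- The functor `H.invFunctor` is a right inverse of `H` up to isomorphism. -/
noncomputable def Hom.invFunctorCompIso : H.invFunctor ⋙ H.functor ≅ 𝟭 Q.obj :=
  NatIso.ofComponents (F := H.invFunctor ⋙ H.functor) (G := 𝟭 Q.obj) (fun y => H.invIso y)
    (fun {y z} g => (congrArg (· ≫ (H.invIso z).hom) (H.map_invFunctor g)).trans
      (show ((H.invIso y).hom ≫ g ≫ (H.invIso z).inv) ≫ (H.invIso z).hom = (H.invIso y).hom ≫ g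
        by simp))

/-- The inverse is a right inverse up to vertical isomorphism. -/
noncomputable def Hom.inverseCompIso : H.inverse.comp H ≅ Hom.id Q :=
  PrunedOpfib.isoMk (F := H.inverse.comp H) (G := Hom.id Q) (BasedNatIso.mkNatIso
    H.invFunctorCompIso
    (fun y => (inferInstance : Q.p.IsHomLift (𝟙 (Q.p.obj y)) (H.invIso y).hom)))

lemma Hom.map_preimageIso (e : P.obj) :
    H.functor.map (H.functor.preimageIso (H.invIso (H.functor.obj e)).symm).hom =
      (H.invIso (H.functor.obj e)).inv := by simp

/-- The functor `H.invFunctor` is a left inverse of `H` up to isomorphism. -/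
noncomputable def Hom.compInvFunctorIso : 𝟭 P.obj ≅ H.functor ⋙ H.invFunctor :=
  NatIso.ofComponents (F := 𝟭 P.obj) (G := H.functor ⋙ H.invFunctor)
    (fun e => H.functor.preimageIso (H.invIso (H.functor.obj e)).symm)
    (fun {e e'} g => H.functor.map_injective ((H.functor.map_comp _ _).trans
      (Eq.trans (show H.functor.map g ≫
          H.functor.map (H.functor.preimageIso (H.invIso (H.functor.obj e')).symm).hom =
        H.functor.map (H.functor.preimageIso (H.invIso (H.functor.obj e)).symm).hom ≫
          H.functor.map (H.invFunctor.map (H.functor.map g)) by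
        rw [map_invFunctor, map_preimageIso, map_preimageIso, Iso.inv_hom_id_assoc])
      (H.functor.map_comp _ (H.invFunctor.map (H.functor.map g))).symm)))

/-- The inverse is a left inverse up to vertical isomorphism. -/
noncomputable def Hom.compInverseIso : Hom.id P ≅ H.comp H.inverse :=
  PrunedOpfib.isoMk (F := Hom.id P) (G := H.comp H.inverse) (BasedNatIso.mkNatIso
    H.compInvFunctorIso
    (fun e => by
      -- The component is vertical because its image under `H`, the inverse of a vertical
      -- isomorphism, is.
      have h : Q.p.IsHomLift (𝟙 (Q.p.obj (H.functor.obj e))) (H.invIso (H.functor.obj e)).inv :=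
        inferInstance
      rw [← map_preimageIso, H.w_obj] at h
      exact H.based.isHomLift_map _ (H.functor.preimageIso (H.invIso (H.functor.obj e)).symm).hom))

end

/-- A morphism of pruned opfibrations that is an equivalence of categories is an equivalence. -/
lemma exists_equivalence {P Q : PrunedOpfib.{v₁, u₁, v, u} A} (H : P ⟶ Q)
    (h : (Hom.functor H).IsEquivalence) : ∃ e : Bicategory.Equivalence P Q, e.hom = H :=
  -- Only the counit is modified in order to obtain the triangle identity, so the underlying
  -- morphism is `H` itself.
  ⟨Bicategory.Equivalence.mkOfAdjointifyCounit (f := H) (g := Hom.inverse H)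
    (Hom.compInverseIso H) (Hom.inverseCompIso H), rfl⟩

/-- An invertible 2-cell gives an isomorphism of functors. -/
def functorIso {P Q : PrunedOpfib.{v₁, u₁, v, u} A} {F G : P ⟶ Q} (e : F ≅ G) :
    Hom.functor F ≅ Hom.functor G where
  hom := BasedNatTrans.toNatTrans e.hom
  inv := BasedNatTrans.toNatTrans e.inv
  hom_inv_id := congrArg BasedNatTrans.toNatTrans e.hom_inv_id
  inv_hom_id := congrArg BasedNatTrans.toNatTrans e.inv_hom_id

lemma isEquivalence_of_isos {P Q : PrunedOpfib.{v₁, u₁, v, u} A} {F : P ⟶ Q} {G : Q ⟶ P}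
    (η : 𝟙 P ≅ F ≫ G) (ε : G ≫ F ≅ 𝟙 Q) : (Hom.functor F).IsEquivalence :=
  (CategoryTheory.Equivalence.mk (Hom.functor F) (Hom.functor G) (functorIso η)
    (functorIso ε)).isEquivalence_functor

/-! ### Transport of the comparison along equivalences -/

section

variable {P : PrunedOpfib.{v₁, u₁, max v₁ v, max u₁ u v₁ v} A}

/-- The comparison functor is an equivalence for every pruned opfibration that is equivalent to a
coEilenberg-Moore opfibration. -/
lemma isEquivalence_compare_of_equivalence
    {S : PrunedComonad.{v₁, u₁, max v₁ v, max u₁ u v₁ v} A}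
    (e : Bicategory.Equivalence P ((PrunedComonad.coEM A).obj S)) : P.compare.IsEquivalence := by
  let W := (assocComonad.{v₁, u₁, max v₁ v, max u₁ u v₁ v} A).comp
    (PrunedComonad.coEM.{v₁, u₁, max v₁ v, max u₁ u v₁ v} A)
  have h₁ : (Hom.functor e.hom).IsEquivalence := isEquivalence_of_isos e.unit e.counit
  -- A pseudofunctor preserves equivalences; here `W` is the composite of the two constructions.
  have h₂ : (Hom.functor (W.map e.hom)).IsEquivalence :=
    isEquivalence_of_isos (G := W.map e.inv)
      ((W.mapId P).symm ≪≫ W.map₂Iso e.unit ≪≫ W.mapComp e.hom e.inv)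
      ((W.mapComp e.inv e.hom).symm ≪≫ W.map₂Iso e.counit ≪≫ W.mapId _)
  have h₃ : (mapComonad e.hom).mapTotal.IsEquivalence := h₂
  have h₄ : (PrunedOpfib.compare ((PrunedComonad.coEM A).obj S)).IsEquivalence :=
    PrunedComonad.isEquivalence_compare.{v₁, u₁, v, u} S
  -- In the naturality square of the comparison at `e.hom` the other three sides are equivalences.
  have h₅ : (P.compare ⋙ (mapComonad e.hom).mapTotal).IsEquivalence :=
    Functor.isEquivalence_of_iso (compareNatIso e.hom)
  exact Functor.isEquivalence_of_comp_right _ (mapComonad e.hom).mapTotal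

end

end PrunedOpfib

end Opfib

/-! ### The main theorem -/

theorem mainTheorem11 (A : Type u₁) [Category.{v₁} A] [HasTerminal A] :
    (∃ η : Pseudofunctor.StrongTrans
        (Pseudofunctor.id (Opfib.PrunedOpfib.{v₁, u₁, max v₁ v, max u₁ u v₁ v} A))
        ((Opfib.PrunedOpfib.assocComonad.{v₁, u₁, max v₁ v, max u₁ u v₁ v} A).comp
          (Opfib.PrunedComonad.coEM.{v₁, u₁, max v₁ v, max u₁ u v₁ v} A)),
      (∀ P, η.app P = Opfib.PrunedOpfib.comparison.{v₁, u₁, v, u} P) ∧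
        Opfib.IsBiadjunctionUnit
          (Opfib.PrunedOpfib.assocComonad.{v₁, u₁, max v₁ v, max u₁ u v₁ v} A)
          (Opfib.PrunedComonad.coEM.{v₁, u₁, max v₁ v, max u₁ u v₁ v} A) η) ∧
    (∀ P : Opfib.PrunedOpfib.{v₁, u₁, max v₁ v, max u₁ u v₁ v} A,
      ((∃ S : Opfib.PrunedComonad.{v₁, u₁, max v₁ v, max u₁ u v₁ v} A,
          Nonempty (Bicategory.Equivalence P
            ((Opfib.PrunedComonad.coEM.{v₁, u₁, max v₁ v, max u₁ u v₁ v} A).obj S))) ↔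
        ∃ e : Bicategory.Equivalence P
            ((Opfib.PrunedComonad.coEM.{v₁, u₁, max v₁ v, max u₁ u v₁ v} A).obj
              ((Opfib.PrunedOpfib.assocComonad.{v₁, u₁, max v₁ v, max u₁ u v₁ v} A).obj P)),
          e.hom = Opfib.PrunedOpfib.comparison.{v₁, u₁, v, u} P) ∧
      ((∃ e : Bicategory.Equivalence P
            ((Opfib.PrunedComonad.coEM.{v₁, u₁, max v₁ v, max u₁ u v₁ v} A).obj
              ((Opfib.PrunedOpfib.assocComonad.{v₁, u₁, max v₁ v, max u₁ u v₁ v} A).obj P)),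
          e.hom = Opfib.PrunedOpfib.comparison.{v₁, u₁, v, u} P) ↔
        P.compare.IsEquivalence)) ∧
    (∀ S : Opfib.PrunedComonad.{v₁, u₁, max v₁ v, max u₁ u v₁ v} A,
      HasInitial S.carrier ↔
        HasInitial (Opfib.TermFiber
          ((Opfib.PrunedComonad.coEM.{v₁, u₁, max v₁ v, max u₁ u v₁ v} A).obj S).p)) := by
  -- The equivalences follow from (i) ⇒ (iii) and (iii) ⇒ (ii). Since (ii) is an instance of (i),
  -- with the comonad of `P` as `S`, the first implication also gives (ii) ⇒ (iii).
  have h₁ (P : Opfib.PrunedOpfib.{v₁, u₁, max v₁ v, max u₁ u v₁ v} A)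
      (S : Opfib.PrunedComonad.{v₁, u₁, max v₁ v, max u₁ u v₁ v} A)
      (h : Nonempty (Bicategory.Equivalence P
        ((Opfib.PrunedComonad.coEM.{v₁, u₁, max v₁ v, max u₁ u v₁ v} A).obj S))) :
      P.compare.IsEquivalence :=
    Opfib.PrunedOpfib.isEquivalence_compare_of_equivalence.{v₁, u₁, v, u} h.some
  have h₂ (P : Opfib.PrunedOpfib.{v₁, u₁, max v₁ v, max u₁ u v₁ v} A)
      (h : P.compare.IsEquivalence) :=
    Opfib.PrunedOpfib.exists_equivalence (Opfib.PrunedOpfib.comparison.{v₁, u₁, v, u} P) h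
  exact ⟨⟨Opfib.PrunedOpfib.comparisonTrans.{v₁, u₁, v, u} A, fun _ => rfl,
      Opfib.PrunedOpfib.isBiadjunctionUnit_comparisonTrans.{v₁, u₁, v, u} A⟩,
    fun P => ⟨⟨fun ⟨S, h⟩ => h₂ P (h₁ P S h), fun ⟨e, _⟩ => ⟨_, ⟨e⟩⟩⟩,
      ⟨fun ⟨e, _⟩ => h₁ P _ ⟨e⟩, h₂ P⟩⟩,
    fun S => S.hasInitial_iff⟩
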